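/- **Setting.** Let $\Omega\subseteq\mathbb C^n$ be a bounded Reinhardt domain, i.e. a bounded, nonempty, connected open set with $tz:=(t_1z_1,\dots,t_nz_n)\in\Omega$ for all $z\in\Omega$ and $t\in\mathbb T^n=\{t\in\mathbb C^n:|t_1|=\dots=|t_n|=1\}$. Write $|\Omega|=\{(|z_1|,\dots,|z_n|):z\in\Omega\}$, $z\bar w=(z_1\bar w_1,\dots,z_n\bar w_n)$ and $\widetilde\Omega=\{z\bar w:z,w\in\Omega\}$. Let $\omega:\Omega\to[0,\infty]$ be a multi-radial weight, i.e. $\omega$ is measurable, positive almost everywhere, and $\omega(z)$ depends only on $(|z_1|,\dots,|z_n|)$. Let $A^2(\Omega,\omega)$ be the space of holomorphic functions $f$ on $\Omega$ with $\|f\|^2=\int_\Omega|f|^2\,\omega\,dV<\infty$. Assume that $\omega$ is admissible: for every compact $K\subset\Omega$ there is $C_K>0$ with $\sup_K|f|\le C_K\|f\|$ for all $f\in A^2(\Omega,\omega)$. Let $\Lambda=\{\alpha\in\mathbb Z^n: z^\alpha\in L^2(\Omega,\omega\,dV)\}$ and let $\|c_\alpha\|$ be the norm of the functional on $A^2(\Omega,\omega)$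 that sends $f$ to its $\alpha$-th Laurent coefficient $c_\alpha(f)$ (a term with $\|c_\alpha\|=0$ in the sums below is read as $0$). Assume that $\Omega$ is feasible with respect to $\omega$: the series $\sum_{\alpha\in\Lambda}\|c_\alpha\|^2z^\alpha$ converges (absolutely) on $\Omega$ to a holomorphic function, and this function has a holomorphic extension to $\Omega\cup\widetilde\Omega$. Let $\mathcal D'(\mathbb T^n)$ be the space of continuous linear functionals on the smooth $\mathbb Z^n$-periodic functions on $\mathbb R^n$, and put $\hat u(\alpha)=\langle u,e^{-2\pi i\alpha\cdot\theta}\rangle$ for $u\in\mathcal D'(\mathbb T^n)$, $\alpha\in\mathbb Z^n$. For $r\in|\Omega|$ let $K_r\in\mathcal D'(\mathbb T^n)$ be the distribution with $\widehat{K_r}(\alpha)=\|c_\alpha\|^2r^\alpha$ for $\alpha\in\Lambda$ and $\widehat{K_r}(\alpha)=0$ for $\alpha\notin\Lambda$. A function $g$ is *induced by* $u$ if, for every $r\in|\Omega|$, the function $\theta\mapsto g(r_1e^{2\pi i\theta_1},\dots,r_ne^{2\pi i\theta_n})$ is the pointwise (absolutely convergent) sum of the Fourier series of $K_r*u$. **Theorem.**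 Let $R:A^2(\Omega,\omega)\to A^2(\Omega,\omega)$ be a map. The following are equivalent. 1. $R$ is a bounded radial operator: it is linear and bounded, and for every $t\in\mathbb T^n$ the operator $(V_tf)(z)=f(tz)$ is bounded on $A^2(\Omega,\omega)$ and $RV_t=V_tR$. 2. There are $u\in\mathcal D'(\mathbb T^n)$ with $\hat u$ bounded on $\Lambda$, and a holomorphic function $g$ on $\Omega\cup\widetilde\Omega$ that is induced by $u$ and satisfies $$g(\zeta)=\sum_{\alpha\in\Lambda}\|c_\alpha\|^2\,\hat u(\alpha)\,\zeta^\alpha\qquad(\zeta\in\Omega\cup\widetilde\Omega,\ \text{absolutely convergent}),$$ such that for all $f\in A^2(\Omega,\omega)$ and $z\in\Omega$ the function $w\mapsto f(w)g(z\bar w)$ is integrable with respect to $\omega\,dV$ on $\Omega$ and $$Rf(z)=\int_\Omega f(w)\,g(z\bar w)\,\omega(w)\,dV(w).$$ -/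

import Mathlib

open MeasureTheory
open scoped ENNReal

namespace RadialBergman

noncomputable section

/-! Holomorphic (complex analytic) functions on an open set `U` of `ℂⁿ` are expressed as
`DifferentiableOn ℂ f U`: complex Fréchet differentiability at every point of `U`. -/

/-! ### Reinhardt domains -/

/-- Nonempty connected open sets of `ℂⁿ` that are invariant under all rotations
`z ↦ (t₁ z₁, …, tₙ zₙ)` with `|t₁| = … = |tₙ| = 1`. -/
structure IsReinhardtDomain {n : ℕ} (Ω : Set (Fin n → ℂ)) : Prop where
  isOpen : IsOpen Ω
  isConnected : IsConnected Ω
  rotate_mem : ∀ t : Fin n → ℂ, (∀ j, ‖t j‖ = 1) → ∀ z ∈ Ω, t * z ∈ Ω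

/-- The Reinhardt shadow `|Ω|`. -/
def shadow {n : ℕ} (Ω : Set (Fin n → ℂ)) : Set (Fin n → ℝ) :=
  {r | ∃ z ∈ Ω, ∀ j, r j = ‖z j‖}

/-- The set `{z w̄ : z, w ∈ Ω}` (entrywise products). It is open whenever `Ω` is. -/
def conjProduct {n : ℕ} (Ω : Set (Fin n → ℂ)) : Set (Fin n → ℂ) :=
  {ζ | ∃ z ∈ Ω, ∃ w ∈ Ω, ζ = z * star w}

/-- The Laurent monomial `z ^ α = z₁ ^ α₁ ⋯ zₙ ^ αₙ`. -/
def monomial {n : ℕ} (α : Fin n → ℤ) (z : Fin n → ℂ) : ℂ :=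
  ∏ j, z j ^ α j

/-! ### Weights and the weighted Bergman space -/

/-- Multi-radial weights `ω : Ω → [0, ∞]`; the values of `ω` outside `Ω` are never used. -/
structure IsMultiRadialWeight {n : ℕ} (Ω : Set (Fin n → ℂ)) (ω : (Fin n → ℂ) → ℝ≥0∞) :
    Prop where
  aemeasurable : AEMeasurable ω (volume.restrict Ω)
  ae_pos : ∀ᵐ z ∂(volume.restrict Ω), 0 < ω z
  multiRadial : ∃ a : (Fin n → ℝ) → ℝ≥0∞, ∀ z ∈ Ω, ω z = a (fun j => ‖z j‖)

/-- The measure `ω dV` on `Ω`. -/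
def weightMeasure {n : ℕ} (Ω : Set (Fin n → ℂ)) (ω : (Fin n → ℂ) → ℝ≥0∞) :
    Measure (Fin n → ℂ) :=
  (volume.restrict Ω).withDensity ω

/-- The weighted Bergman space `A²(Ω, ω)`: the holomorphic functions on `Ω` that belong to
`L²(Ω, ω dV)`. A function on `Ω` is represented by its extension by `0` to `ℂⁿ`, so that every
element has exactly one representative. -/
def BergmanSpace {n : ℕ} (Ω : Set (Fin n → ℂ)) (ω : (Fin n → ℂ) → ℝ≥0∞) :
    Submodule ℂ ((Fin n → ℂ) → ℂ) where
  carrier := {f | DifferentiableOn ℂ f Ω ∧ (∀ z, z ∉ Ω → f z = 0) ∧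
    MemLp f 2 (weightMeasure Ω ω)}
  add_mem' := by
    rintro f g ⟨hf, hf0, hfm⟩ ⟨hg, hg0, hgm⟩
    exact ⟨hf.add hg, fun z hz => by simp [hf0 z hz, hg0 z hz], hfm.add hgm⟩
  zero_mem' := ⟨differentiableOn_const 0, fun _ _ => rfl, MemLp.zero⟩
  smul_mem' := by
    rintro c f ⟨hf, hf0, hfm⟩
    exact ⟨hf.const_smul c, fun z hz => by simp [hf0 z hz], hfm.const_smul c⟩

/-- The norm `‖f‖_{2,ω} = (∫_Ω |f|² ω dV)^{1/2}`. -/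
def bergmanNorm {n : ℕ} {Ω : Set (Fin n → ℂ)} {ω : (Fin n → ℂ) → ℝ≥0∞}
    (f : BergmanSpace Ω ω) : ℝ :=
  (eLpNorm (f : (Fin n → ℂ) → ℂ) 2 (weightMeasure Ω ω)).toReal

/-- Admissible weights: on every compact subset of `Ω` the supremum norm is controlled by the
norm of `A²(Ω, ω)`. -/
def IsAdmissible {n : ℕ} (Ω : Set (Fin n → ℂ)) (ω : (Fin n → ℂ) → ℝ≥0∞) : Prop :=
  ∀ K : Set (Fin n → ℂ), IsCompact K → K ⊆ Ω →
    ∃ C : ℝ, 0 < C ∧ ∀ f : BergmanSpace Ω ω, ∀ z ∈ K, ‖f.1 z‖ ≤ C * bergmanNorm f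

/-- The set `Λ` of allowable multi-indices: those `α` for which `z ^ α` is in `L²(Ω, ω dV)`. -/
def allowable {n : ℕ} (Ω : Set (Fin n → ℂ)) (ω : (Fin n → ℂ) → ℝ≥0∞) : Set (Fin n → ℤ) :=
  {α | MemLp (monomial α) 2 (weightMeasure Ω ω)}

/-- `f(z) = ∑_{α ∈ ℤⁿ} c_α z ^ α` for all `z ∈ Ω`. On a Reinhardt domain every holomorphic
function has exactly one such expansion. -/
def HasLaurentExpansion {n : ℕ} (Ω : Set (Fin n → ℂ)) (f : (Fin n → ℂ) → ℂ)
    (c : (Fin n → ℤ) → ℂ) : Prop :=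
  ∀ z ∈ Ω, HasSum (fun α => c α * monomial α z) (f z)

open Classical in
/-- The `α`-th coordinate functional `c_α`: the `α`-th Laurent coefficient of `f` on `Ω`. -/
def laurentCoeff {n : ℕ} (Ω : Set (Fin n → ℂ)) (α : Fin n → ℤ) (f : (Fin n → ℂ) → ℂ) : ℂ :=
  if h : ∃ c, HasLaurentExpansion Ω f c then h.choose α else 0

/-- The norm `‖c_α‖` of the coordinate functional `c_α : A²(Ω, ω) → ℂ`. -/
def coeffNorm {n : ℕ} (Ω : Set (Fin n → ℂ)) (ω : (Fin n → ℂ) → ℝ≥0∞) (α : Fin n → ℤ) : ℝ :=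
  sInf {C : ℝ | 0 ≤ C ∧ ∀ f : BergmanSpace Ω ω, ‖laurentCoeff Ω α f.1‖ ≤ C * bergmanNorm f}

/-- Feasibility of `Ω` with respect to `ω`: the series `∑_{α ∈ Λ} ‖c_α‖² z ^ α` defines a
holomorphic function on `Ω` that has a holomorphic extension to `{z w̄ : z, w ∈ Ω}`. -/
def IsFeasible {n : ℕ} (Ω : Set (Fin n → ℂ)) (ω : (Fin n → ℂ) → ℝ≥0∞) : Prop :=
  ∃ g : (Fin n → ℂ) → ℂ, DifferentiableOn ℂ g (Ω ∪ conjProduct Ω) ∧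
    ∀ z ∈ Ω, HasSum
      (fun α : allowable Ω ω => ((coeffNorm Ω ω α ^ 2 : ℝ) : ℂ) * monomial (α : Fin n → ℤ) z)
      (g z)

/-! ### Bounded and radial operators -/

/-- Bounded linear operators on `A²(Ω, ω)`. -/
structure IsBoundedOperator {n : ℕ} {Ω : Set (Fin n → ℂ)} {ω : (Fin n → ℂ) → ℝ≥0∞}
    (R : BergmanSpace Ω ω → BergmanSpace Ω ω) : Prop where
  isLinear : IsLinearMap ℂ R
  bounded : ∃ C : ℝ, ∀ f, bergmanNorm (R f) ≤ C * bergmanNorm f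

/-- `R` is radial: for all `t ∈ 𝕋ⁿ`, `(V_t f)(z) = f(t z)` defines a bounded operator `V_t` on
`A²(Ω, ω)`, and `R V_t = V_t R`. -/
def IsRadial {n : ℕ} {Ω : Set (Fin n → ℂ)} {ω : (Fin n → ℂ) → ℝ≥0∞}
    (R : BergmanSpace Ω ω → BergmanSpace Ω ω) : Prop :=
  ∀ t : Fin n → ℂ, (∀ j, ‖t j‖ = 1) →
    ∃ V : BergmanSpace Ω ω → BergmanSpace Ω ω,
      IsBoundedOperator V ∧ (∀ f, ∀ z ∈ Ω, (V f).1 z = f.1 (t * z)) ∧ ∀ f, R (V f) = V (R f)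

/-! ### Periodic distributions -/

/-- `C^∞(𝕋ⁿ)`, as the space of smooth `ℤⁿ`-periodic functions on `ℝⁿ`. -/
def TestFunction (n : ℕ) : Submodule ℂ ((Fin n → ℝ) → ℂ) where
  carrier := {φ | ContDiff ℝ ((⊤ : ℕ∞) : WithTop ℕ∞) φ ∧ ∀ (x : Fin n → ℝ) (k : Fin n → ℤ),
    φ (x + fun j => (k j : ℝ)) = φ x}
  add_mem' := by
    rintro f g ⟨hf, hf'⟩ ⟨hg, hg'⟩
    exact ⟨hf.add hg, fun x k => by simp [hf' x k, hg' x k]⟩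
  zero_mem' := ⟨contDiff_const, fun _ _ => rfl⟩
  smul_mem' := by
    rintro c f ⟨hf, hf'⟩
    exact ⟨contDiff_const.smul hf, fun x k => by simp [hf' x k]⟩

/-- The character `x ↦ exp(2πi α·x)`. -/
def character {n : ℕ} (α : Fin n → ℤ) (x : Fin n → ℝ) : ℂ :=
  Complex.exp (2 * Real.pi * Complex.I * ∑ j, (α j : ℂ) * (x j : ℂ))

theorem character_mem {n : ℕ} (α : Fin n → ℤ) : character α ∈ TestFunction n := by
  refine ⟨?_, fun x k => ?_⟩
  · unfold character
    refine Complex.contDiff_exp.comp (contDiff_const.mul (ContDiff.sum fun j _ => ?_))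
    exact contDiff_const.mul (Complex.ofRealCLM.contDiff.comp (contDiff_apply ℝ ℝ j))
  · unfold character
    rw [Complex.exp_eq_exp_iff_exists_int]
    refine ⟨∑ j, α j * k j, ?_⟩
    simp only [Pi.add_apply, Complex.ofReal_add, Complex.ofReal_intCast, mul_add,
      Finset.sum_add_distrib, Int.cast_sum, Int.cast_mul]
    ring

/-- The translate `y ↦ φ(x + y)` of a test function. -/
def translate {n : ℕ} (x : Fin n → ℝ) (φ : TestFunction n) : TestFunction n :=
  ⟨fun y => φ.1 (x + y), φ.2.1.comp (contDiff_const.add contDiff_id),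
    fun y k => by simpa [add_assoc] using φ.2.2 (x + y) k⟩

/-- `𝒟'(𝕋ⁿ)`: the linear functionals on `C^∞(𝕋ⁿ)` that are continuous, that is, bounded by a
multiple of the supremum norms of finitely many derivatives. -/
structure PeriodicDistribution (n : ℕ) where
  toLinearMap : TestFunction n →ₗ[ℂ] ℂ
  continuous : ∃ (N : ℕ) (C : ℝ), ∀ (φ : TestFunction n) (M : ℝ),
    (∀ m ≤ N, ∀ x, ‖iteratedFDeriv ℝ m φ.1 x‖ ≤ M) → ‖toLinearMap φ‖ ≤ C * M

/-- The Fourier coefficient `û(α) = ⟨u, exp(-2πi α·x)⟩`. -/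
def PeriodicDistribution.fourierCoeff {n : ℕ} (u : PeriodicDistribution n) (α : Fin n → ℤ) : ℂ :=
  u.toLinearMap ⟨character (-α), character_mem (-α)⟩

/-- `w = u * v` as periodic distributions: `⟨w, φ⟩ = ⟨u, ψ⟩` for every test function `φ`, where
`ψ` is the convolution of the reflection of `v` with `φ`, that is, `ψ(x) = ⟨v, φ(x + ·)⟩`. -/
def IsConvolution {n : ℕ} (u v w : PeriodicDistribution n) : Prop :=
  ∀ φ : TestFunction n, ∃ ψ : TestFunction n,
    (∀ x, ψ.1 x = v.toLinearMap (translate x φ)) ∧ w.toLinearMap φ = u.toLinearMap ψ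

/-! ### Functions induced by a periodic distribution -/

/-- `g` is induced by `u`: for each `r ∈ |Ω|` the function `g_r` on the torus,
`g_r(θ) = g(r₁ e^{2πiθ₁}, …, rₙ e^{2πiθₙ})`, is the sum of the Fourier series of `K_r * u`, where
`K_r` is the periodic distribution with Fourier coefficients `‖c_α‖² r ^ α` for `α ∈ Λ` and `0`
for `α ∉ Λ`. -/
def IsInducedBy {n : ℕ} (Ω : Set (Fin n → ℂ)) (ω : (Fin n → ℂ) → ℝ≥0∞)
    (g : (Fin n → ℂ) → ℂ) (u : PeriodicDistribution n) : Prop :=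
  ∀ r ∈ shadow Ω, ∃ K w : PeriodicDistribution n,
    (∀ α, K.fourierCoeff α = (allowable Ω ω).indicator
      (fun β => ((coeffNorm Ω ω β ^ 2 : ℝ) : ℂ) * monomial β (fun j => (r j : ℂ))) α) ∧
    IsConvolution K u w ∧
    ∀ θ : Fin n → ℝ, HasSum (fun α => w.fourierCoeff α * character α θ)
      (g (fun j => (r j : ℂ) * Complex.exp (2 * Real.pi * Complex.I * (θ j : ℂ))))

end

end RadialBergman

/-!
# Bounded radial operators on weighted Bergman spaces are integral operators

Both sides of the equivalence say that `R` is diagonal in the orthonormal basis of normalised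
monomials `e_α = ‖c_α‖ z ^ α`, with a bounded sequence of eigenvalues `û(α)`.

*The basis.* Averaging `f(t z) t ^ (-α)` over `t ∈ 𝕋ⁿ` gives a holomorphic function that is
homogeneous of multidegree `α`, hence a multiple of `z ^ α` (`exists_eq_const_mul_monomial`), and
this multiple is the `α`-th Laurent term of `f`. Since `ω dV` is rotation invariant, the `e_α` are
orthonormal in `L²(Ω, ω dV)`; admissibility gives `∑ |e_α(z)|² < ∞` (`summable_sq_basisElt`).
With Bessel's inequality, the Laurent series of `f` converges absolutely, and it converges to `f`
because both have the same Fourier coefficients on each torus (`hasLaurentExpansion_laurentCoeff`).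
It also converges in `L²` (`hasSum_inner_smul_basisElt`), and
`‖c_α‖ = 1 / ‖z ^ α‖` or `‖c_α‖ = 0` according to whether or not `z ^ α` lies in the Bergman space.

*From operators to kernels.* `R e_α` is again homogeneous of multidegree `α`, so
`R e_α = l_α e_α` with `l` bounded (`exists_eigenvalues`). The series
`g(ζ) = ∑ ‖c_α‖² l_α ζ ^ α` is dominated by the Bergman kernel, so it converges absolutely on
`Ω` by feasibility and on the products `z w̄` by Cauchy-Schwarz. Absolute convergence of a Laurent
series on an open set is automatically locally uniform (`exists_summable_bound_of_summable`), so `g`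
is holomorphic. Expanding in the basis gives `R f(z) = ∫ f(w) g(z w̄) ω dV`.
The distribution `u` is `∑ l_α e^{2πiα·θ}`; it exists because Fourier coefficients of smooth
functions decay rapidly, and convolution of such distributions multiplies coefficients
(`isConvolution_ofCoeff`).

*From kernels to operators.* Integration against `g(z w̄)` multiplies the coefficient of `e_α` by
`û(α)` (`hasSum_integral_kernel`), so `R` is bounded; it commutes with rotations by the change of
variables `w ↦ t w`.
-/

open Filter Topology Metric Set
open UnitAddTorus

namespace RadialBergman

variable {n : ℕ}

/-! ### Holomorphic functions of several variables -/

/-- Identity theorem in several variables, reduced to one variable by restricting to complex lines. -/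
theorem eqOn_zero_of_eventuallyEq_zero {E : Type*} [NormedAddCommGroup E] [NormedSpace ℂ E]
    {U : Set E} (hU : IsOpen U) (hUc : IsPreconnected U) {f : E → ℂ}
    (hf : DifferentiableOn ℂ f U) {z₀ : E} (hz₀ : z₀ ∈ U) (h : f =ᶠ[𝓝 z₀] 0) :
    EqOn f 0 U := by
  have hsub : U ⊆ {z | f =ᶠ[𝓝 z] 0} := by
    refine hUc.subset_of_closure_inter_subset (isOpen_setOfPred_eventually_nhds) ⟨z₀, hz₀, h⟩ ?_
    rintro z ⟨hzcl, hzU⟩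
    obtain ⟨ρ, hρ, hball⟩ := Metric.isOpen_iff.1 hU z hzU
    obtain ⟨p, hpb, hp⟩ := mem_closure_iff.1 hzcl (ball z ρ) isOpen_ball (mem_ball_self hρ)
    have key : ∀ q ∈ ball z ρ, f q = 0 := by
      intro q hq
      set L : ℂ → E := fun t => p + t • (q - p) with hL
      have hLc : Differentiable ℂ L := by fun_prop
      set V : Set ℂ := L ⁻¹' ball z ρ with hV
      have hVo : IsOpen V := isOpen_ball.preimage hLc.continuous
      have hVc : IsPreconnected V := by
        refine Convex.isPreconnected (?_ : Convex ℝ V)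
        intro a ha b hb s t hs ht hst
        have := (convex_ball z ρ) ha hb hs ht hst
        rw [hV, mem_preimage]
        convert this using 1
        calc L (s • a + t • b) = (s + t) • p + (s • a + t • b) • (q - p) := by
              rw [hst, one_smul]
          _ = s • L a + t • L b := by
              simp only [hL, smul_add, add_smul, smul_assoc]
              abel
      have hφ : DifferentiableOn ℂ (f ∘ L) V :=
        hf.comp hLc.differentiableOn fun t ht => hball ht
      have h0 : L 0 = p := by simp [hL]
      have hφ0 : f ∘ L =ᶠ[𝓝 0] 0 := by
        have : Tendsto L (𝓝 0) (𝓝 p) := by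
          simpa [h0] using hLc.continuous.tendsto 0
        exact this.eventually hp
      have := (hφ.analyticOnNhd hVo).eqOn_zero_of_preconnected_of_eventuallyEq_zero hVc
        (show (0 : ℂ) ∈ V by simpa [hV, h0] using hpb) hφ0
      have h1 : L 1 = q := by simp [hL]
      have := this (show (1 : ℂ) ∈ V by simpa [hV, h1] using hq)
      simpa [h1] using this
    exact eventually_of_mem (ball_mem_nhds z hρ) key
  exact fun z hz => (hsub hz).self_of_nhds

/-- Cauchy estimate for the Fréchet derivative, from the one on complex lines through `z`. -/
theorem norm_fderiv_le_of_norm_le {E : Type*} [NormedAddCommGroup E] [NormedSpace ℂ E]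
    {f : E → ℂ} {z : E} {r M : ℝ} (hr : 0 < r) (hf : DifferentiableOn ℂ f (ball z (2 * r)))
    (hM : ∀ x ∈ ball z (2 * r), ‖f x‖ ≤ M) : ‖fderiv ℂ f z‖ ≤ M / r := by
  have hzm : z ∈ ball z (2 * r) := mem_ball_self (by positivity)
  have hM0 : 0 ≤ M := (norm_nonneg _).trans (hM z hzm)
  refine ContinuousLinearMap.opNorm_le_bound _ (by positivity) fun v => ?_
  rcases eq_or_ne v 0 with rfl | hv
  · simp
  have hv' : 0 < ‖v‖ := norm_pos_iff.2 hv
  set L : ℂ → E := fun t => z + t • v with hL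
  have hmem : ∀ t ∈ closedBall (0 : ℂ) (r / ‖v‖), L t ∈ ball z (2 * r) := by
    intro t ht
    rw [mem_closedBall_zero_iff, le_div_iff₀ hv'] at ht
    simp only [hL, mem_ball, dist_self_add_left, norm_smul]
    linarith
  have hfz : DifferentiableAt ℂ f (L 0) := by
    simpa [hL] using hf.differentiableAt (isOpen_ball.mem_nhds hzm)
  have hLd : HasDerivAt L v 0 := by
    simpa [hL] using ((hasDerivAt_id (0 : ℂ)).smul_const v).const_add z
  have hd : deriv (f ∘ L) 0 = fderiv ℂ f z v := by
    have := (hfz.hasFDerivAt.comp_hasDerivAt 0 hLd).deriv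
    simpa [hL] using this
  rw [← hd]
  have hLc : Differentiable ℂ L := by fun_prop
  have := Complex.norm_deriv_le_of_forall_mem_sphere_norm_le (c := 0) (f := f ∘ L) (C := M)
    (R := r / ‖v‖) (by positivity)
    (by
      refine DifferentiableOn.diffContOnCl ?_
      rw [closure_ball _ (by positivity)]
      exact hf.comp hLc.differentiableOn hmem)
    (fun t ht => hM _ (hmem t (sphere_subset_closedBall ht)))
  calc _ ≤ _ := this
    _ = _ := by field_simp

/-- A normally convergent series of holomorphic functions is holomorphic: Cauchy estimates bound the
derivatives termwise. -/
theorem differentiableAt_tsum_of_norm_le {E ι : Type*} [NormedAddCommGroup E] [NormedSpace ℂ E]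
    {f : ι → E → ℂ} {b : ι → ℝ} {z : E} {ρ : ℝ} (hρ : 0 < ρ) (hb : Summable b)
    (hf : ∀ i, DifferentiableOn ℂ (f i) (ball z ρ)) (hfb : ∀ i, ∀ x ∈ ball z ρ, ‖f i x‖ ≤ b i) :
    DifferentiableAt ℂ (fun x => ∑' i, f i x) z := by
  have hsub : ∀ x ∈ ball z (ρ / 3), ball x (2 * (ρ / 3)) ⊆ ball z ρ := by
    intro x hx
    refine ball_subset_ball' ?_
    rw [mem_ball] at hx
    linarith
  have hz : z ∈ ball z (ρ / 3) := mem_ball_self (by positivity)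
  have hzρ : z ∈ ball z ρ := mem_ball_self hρ
  refine (hasFDerivAt_tsum_of_isPreconnected (𝕜 := ℂ) (u := fun i => b i / (ρ / 3))
    (f' := fun i x => fderiv ℂ (f i) x)
    (hb.div_const _) isOpen_ball (convex_ball z (ρ / 3)).isPreconnected
    (fun i x hx => ((hf i).differentiableAt ?_).hasFDerivAt)
    (fun i x hx => norm_fderiv_le_of_norm_le (by positivity) ((hf i).mono (hsub x hx))
      fun y hy => hfb i y (hsub x hx hy)) hz
    (Summable.of_norm_bounded hb fun i => hfb i z hzρ) hz).differentiableAt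
  exact isOpen_ball.mem_nhds (ball_subset_ball (by linarith) hx)

/-! ### Laurent monomials -/

section Monomial

theorem monomial_mul (α : Fin n → ℤ) (z w : Fin n → ℂ) :
    monomial α (z * w) = monomial α z * monomial α w := by
  simp [monomial, mul_zpow, Finset.prod_mul_distrib]

theorem monomial_star (α : Fin n → ℤ) (z : Fin n → ℂ) :
    monomial α (star z) = star (monomial α z) := by
  simp [monomial]

theorem monomial_ne_zero {α : Fin n → ℤ} {z : Fin n → ℂ} (hz : ∀ j, z j ≠ 0) :
    monomial α z ≠ 0 :=
  Finset.prod_ne_zero_iff.2 fun j _ => zpow_ne_zero _ (hz j)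

theorem norm_monomial (α : Fin n → ℤ) (z : Fin n → ℂ) :
    ‖monomial α z‖ = ∏ j, ‖z j‖ ^ α j := by
  simp [monomial, norm_prod]

theorem measurable_monomial (α : Fin n → ℤ) : Measurable (monomial α) := by
  unfold monomial
  refine Finset.measurable_prod _ fun j _ => ?_
  have : Measurable (fun z : ℂ => z ^ α j) := by
    rcases Int.eq_nat_or_neg (α j) with ⟨k, hk | hk⟩ <;> rw [hk]
    · simpa using measurable_id.pow_const (β := ℂ) k
    · simpa [Pi.inv_def] using (measurable_id.pow_const (β := ℂ) k).inv
  exact this.comp (measurable_pi_apply j)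

/-- No variable that vanishes somewhere on `Ω` carries a negative exponent in `α`. Exactly then is
`z ^ α` holomorphic on `Ω`. -/
def IsRegularOn (α : Fin n → ℤ) (Ω : Set (Fin n → ℂ)) : Prop :=
  ∀ z ∈ Ω, ∀ j, z j = 0 → 0 ≤ α j

theorem differentiableAt_monomial {α : Fin n → ℤ} {z : Fin n → ℂ}
    (h : ∀ j, z j = 0 → 0 ≤ α j) : DifferentiableAt ℂ (monomial α) z := by
  unfold monomial
  have key : ∀ j ∈ Finset.univ, HasFDerivAt (fun w : Fin n → ℂ => w j ^ α j)
      (fderiv ℂ (fun w : Fin n → ℂ => w j ^ α j) z) z := fun j _ =>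
    DifferentiableAt.hasFDerivAt ?_
  · exact (HasFDerivAt.finsetProd key).differentiableAt
  refine DifferentiableAt.zpow (by fun_prop) ?_
  by_cases hz : z j = 0
  · exact Or.inr (h j hz)
  · exact Or.inl hz

theorem IsRegularOn.differentiableOn {α : Fin n → ℤ} {Ω : Set (Fin n → ℂ)}
    (h : IsRegularOn α Ω) : DifferentiableOn ℂ (monomial α) Ω :=
  fun z hz => (differentiableAt_monomial (h z hz)).differentiableWithinAt

theorem exists_mem_forall_ne_zero {Ω : Set (Fin n → ℂ)} (hΩ : IsOpen Ω) {z : Fin n → ℂ}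
    (hz : z ∈ Ω) : ∃ w ∈ Ω, ∀ j, w j ≠ 0 := by
  have hd : Dense (Set.pi (Set.univ : Set (Fin n)) fun _ => ({0}ᶜ : Set ℂ)) :=
    dense_pi _ fun i _ => dense_compl_singleton 0
  obtain ⟨w, hw, hw'⟩ := hd.inter_open_nonempty Ω hΩ ⟨z, hz⟩
  exact ⟨w, hw, fun j => hw' j (mem_univ j)⟩

end Monomial

/-! ### Homogeneous functions on Reinhardt domains -/

section Homogeneous

/-- Rotation invariance kills the derivatives in the angular directions `i z_j e_j`, which span `ℂⁿ`
over `ℂ` away from the coordinate hyperplanes. -/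
theorem fderiv_eq_zero_of_rotation_invariant {q : (Fin n → ℂ) → ℂ} {z : Fin n → ℂ}
    (hz : ∀ j, z j ≠ 0) (hq : DifferentiableAt ℂ q z)
    (hinv : ∀ t : Fin n → ℂ, (∀ j, ‖t j‖ = 1) → q (t * z) = q z) : fderiv ℂ q z = 0 := by
  have key : ∀ j, fderiv ℂ q z (Pi.single j (Complex.I * z j)) = 0 := by
    intro j
    set γ : ℝ → Fin n → ℂ := fun s =>
      Function.update (1 : Fin n → ℂ) j (Complex.exp (s * Complex.I)) * z with hγ
    have hγ0 : γ 0 = z := by simp [hγ]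
    have hγd : HasDerivAt γ (Pi.single j (Complex.I * z j)) 0 := by
      rw [hasDerivAt_pi]
      intro i
      rcases eq_or_ne i j with rfl | hij
      · have h1 : HasDerivAt (fun s : ℝ => Complex.exp (s * Complex.I)) Complex.I 0 := by
          have := ((Complex.ofRealCLM.hasDerivAt (x := (0 : ℝ))).mul_const Complex.I).cexp
          simpa using this
        simpa [hγ] using h1.mul_const (z i)
      · simpa [hγ, hij] using hasDerivAt_const (0 : ℝ) (z i)
    have hqd : HasFDerivAt q ((fderiv ℂ q z).restrictScalars ℝ) (γ 0) := by
      rw [hγ0]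
      exact hq.hasFDerivAt.restrictScalars ℝ
    have hcomp := hqd.comp_hasDerivAt 0 hγd
    have hconst : q ∘ γ = fun _ => q z := by
      funext s
      refine hinv _ fun i => ?_
      rcases eq_or_ne i j with rfl | hij
      · simp [Complex.norm_exp_ofReal_mul_I]
      · simp [hij]
    rw [hconst] at hcomp
    simpa using hcomp.unique (hasDerivAt_const (0 : ℝ) (q z))
  refine ContinuousLinearMap.coe_injective (LinearMap.pi_ext fun j v => ?_)
  have hv : (Pi.single j v : Fin n → ℂ)
      = (v / (Complex.I * z j)) • (Pi.single j (Complex.I * z j) : Fin n → ℂ) := by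
    rw [← Pi.single_smul, smul_eq_mul,
      div_mul_cancel₀ _ (mul_ne_zero Complex.I_ne_zero (hz j))]
  rw [hv]
  simp [key]

/-- A holomorphic function on a Reinhardt domain that is homogeneous of multidegree `α` under
rotations is a multiple of `z ^ α`, and the multiple is nonzero only if `z ^ α` is holomorphic. -/
theorem exists_eq_const_mul_monomial {Ω : Set (Fin n → ℂ)} (hΩ : IsReinhardtDomain Ω)
    {h : (Fin n → ℂ) → ℂ} (hh : DifferentiableOn ℂ h Ω) {α : Fin n → ℤ}
    (hom : ∀ t : Fin n → ℂ, (∀ j, ‖t j‖ = 1) → ∀ z ∈ Ω, h (t * z) = monomial α t * h z) :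
    ∃ c : ℂ, (∀ z ∈ Ω, h z = c * monomial α z) ∧ (c ≠ 0 → IsRegularOn α Ω) := by
  obtain ⟨z₁, hz₁⟩ := hΩ.isConnected.nonempty
  obtain ⟨p, hp, hp0⟩ := exists_mem_forall_ne_zero hΩ.isOpen hz₁
  have hopen : IsOpen (Ω ∩ ⋂ j, {z : Fin n → ℂ | z j ≠ 0}) :=
    hΩ.isOpen.inter (isOpen_iInter_of_finite fun j =>
      isOpen_ne_fun (continuous_apply j) continuous_const)
  obtain ⟨ρ, hρ, hball⟩ := Metric.isOpen_iff.1 hopen p ⟨hp, mem_iInter.2 hp0⟩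
  have hbΩ : ∀ z ∈ ball p ρ, z ∈ Ω := fun z hz => (hball hz).1
  have hb0 : ∀ z ∈ ball p ρ, ∀ j, z j ≠ 0 := fun z hz => mem_iInter.1 (hball hz).2
  -- On polydiscs away from the coordinate hyperplanes, `h z ^ (-α)` is rotation invariant.
  set q : (Fin n → ℂ) → ℂ := fun z => h z * monomial (-α) z with hq
  have hmul : ∀ z : Fin n → ℂ, (∀ j, z j ≠ 0) → monomial α z * monomial (-α) z = 1 := by
    intro z hz
    rw [monomial, monomial, ← Finset.prod_mul_distrib]
    refine Finset.prod_eq_one fun j _ => ?_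
    rw [Pi.neg_apply, zpow_neg, mul_inv_cancel₀ (zpow_ne_zero _ (hz j))]
  have hqd : ∀ z ∈ ball p ρ, DifferentiableAt ℂ q z := fun z hz =>
    (hh.differentiableAt (hΩ.isOpen.mem_nhds (hbΩ z hz))).mul
      (differentiableAt_monomial fun j hj => absurd hj (hb0 z hz j))
  have hqconst : ∀ z ∈ ball p ρ, q z = q p := by
    intro z hz
    refine isOpen_ball.is_const_of_fderiv_eq_zero (𝕜 := ℂ) (convex_ball p ρ).isPreconnected
      (fun w hw => (hqd w hw).differentiableWithinAt) (fun w hw => ?_) hz (mem_ball_self hρ)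
    refine fderiv_eq_zero_of_rotation_invariant (hb0 w hw) (hqd w hw) fun t ht => ?_
    simp only [hq]
    rw [hom t ht w (hbΩ w hw), monomial_mul]
    have := hmul t fun j hj => by simpa [hj] using ht j
    linear_combination (h w * monomial (-α) w) * this
  set c := q p with hc
  have hloc : ∀ z ∈ ball p ρ, h z = c * monomial α z := by
    intro z hz
    rw [← hqconst z hz]
    have := hmul z (hb0 z hz)
    simp only [hq]
    linear_combination (- h z) * this
  -- Clearing denominators makes both sides holomorphic on all of `Ω`.
  set β : Fin n → ℤ := fun j => max (-α j) 0 with hβ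
  set γ : Fin n → ℤ := fun j => max (α j) 0 with hγ
  have hfac : ∀ z : Fin n → ℂ, (∀ j, z j ≠ 0 ∨ α j = 0) →
      monomial γ z = monomial α z * monomial β z := by
    intro z hz
    rw [monomial, monomial, monomial, ← Finset.prod_mul_distrib]
    refine Finset.prod_congr rfl fun j _ => ?_
    rcases hz j with h0 | h0
    · rw [← zpow_add₀ h0]
      congr 1
      simp only [hβ, hγ]
      omega
    · simp [hβ, hγ, h0]
  have hdβ : DifferentiableOn ℂ (monomial β) Ω :=
    IsRegularOn.differentiableOn fun z _ j _ => le_max_right _ _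
  have hdγ : DifferentiableOn ℂ (monomial γ) Ω :=
    IsRegularOn.differentiableOn fun z _ j _ => le_max_right _ _
  have hH : EqOn (fun z => h z * monomial β z - c * monomial γ z) 0 Ω := by
    refine eqOn_zero_of_eventuallyEq_zero hΩ.isOpen hΩ.isConnected.isPreconnected
      ((hh.mul hdβ).sub (hdγ.const_mul c)) hp ?_
    refine eventually_of_mem (ball_mem_nhds p hρ) fun z hz => ?_
    simp only [Pi.zero_apply]
    rw [hloc z hz, hfac z fun j => Or.inl (hb0 z hz j)]
    ring
  have hH' : ∀ z ∈ Ω, h z * monomial β z = c * monomial γ z := fun z hz =>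
    sub_eq_zero.1 (hH hz)
  refine ⟨c, fun z hz => ?_, fun hc0 z hz j hj => ?_⟩
  · by_cases hex : ∃ j, z j = 0 ∧ α j ≠ 0
    · obtain ⟨j, hj, hαj⟩ := hex
      have hmz : monomial α z = 0 :=
        Finset.prod_eq_zero (Finset.mem_univ j) (by rw [hj, zero_zpow _ hαj])
      -- A rotation of the vanishing variable fixes `z` and multiplies `h z` by `-1`.
      set t : Fin n → ℂ := Function.update 1 j
        (Complex.exp (((Real.pi / α j : ℝ) : ℂ) * Complex.I)) with ht
      have htz : t * z = z := by
        funext i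
        rcases eq_or_ne i j with rfl | hij
        · simp [hj]
        · simp [ht, hij]
      have ht1 : ∀ i, ‖t i‖ = 1 := by
        intro i
        rcases eq_or_ne i j with rfl | hij
        · rw [ht, Function.update_self, Complex.norm_exp_ofReal_mul_I]
        · simp [ht, hij]
      have htm : monomial α t = -1 := by
        rw [monomial, Finset.prod_eq_single j]
        · rw [ht, Function.update_self, ← Complex.exp_int_mul, ← Complex.exp_pi_mul_I]
          congr 1
          have : (α j : ℂ) ≠ 0 := by exact_mod_cast hαj
          push_cast
          field_simp
        · intro i _ hij
          simp [ht, hij]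
        · simp
      have := hom t ht1 z hz
      rw [htz, htm] at this
      rw [hmz, mul_zero]
      linear_combination this / 2
    · push Not at hex
      have hz' : ∀ j, z j ≠ 0 ∨ α j = 0 := fun j => by
        by_cases hj : z j = 0
        · exact Or.inr (hex j hj)
        · exact Or.inl hj
      have hβ0 : monomial β z ≠ 0 := by
        refine Finset.prod_ne_zero_iff.2 fun j _ => ?_
        rcases hz' j with h0 | h0
        · exact zpow_ne_zero _ h0
        · simp [hβ, h0]
      refine mul_right_cancel₀ hβ0 ?_
      rw [hH' z hz, hfac z hz']
      ring
  · by_contra hneg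
    push Not at hneg
    have hcont : Continuous fun w : Fin n → ℂ => Function.update w j (0 : ℂ) :=
      continuous_id.update j continuous_const
    have hzz : Function.update z j (0 : ℂ) = z := by rw [← hj, Function.update_eq_self]
    obtain ⟨w, hw, hw0⟩ := exists_mem_forall_ne_zero (hΩ.isOpen.preimage hcont)
      (z := z) (by rw [mem_preimage, hzz]; exact hz)
    have := hH' (Function.update w j 0) hw
    rw [show monomial β (Function.update w j 0) = 0 from
      Finset.prod_eq_zero (Finset.mem_univ j) (by
        rw [Function.update_self, zero_zpow]
        simp only [hβ]
        omega), mul_zero] at this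
    refine mul_ne_zero hc0 (Finset.prod_ne_zero_iff.2 fun i _ => ?_) this.symm
    rcases eq_or_ne i j with rfl | hij
    · have : γ i = 0 := max_eq_right hneg.le
      simp [this]
    · rw [Function.update_of_ne hij]
      exact zpow_ne_zero _ (hw0 i)

end Homogeneous

/-! ### Absolutely convergent Laurent series -/

section LaurentSeries

/-- An absolutely convergent Laurent series on an open set is locally dominated: near `z₀` the moduli of
its terms are bounded by the sums of their values at the `2 ^ n` corners of a polyannulus around `z₀`. -/
theorem exists_summable_bound_of_summable {U : Set (Fin n → ℂ)} (hU : IsOpen U) {ι : Type*}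
    {e : ι → Fin n → ℤ} {a : ι → ℂ}
    (ha : ∀ z ∈ U, Summable fun i => ‖a i * monomial (e i) z‖)
    (hreg : ∀ i, a i ≠ 0 → IsRegularOn (e i) U) {z₀ : Fin n → ℂ} (hz₀ : z₀ ∈ U) :
    ∃ ρ > 0, ball z₀ ρ ⊆ U ∧ ∃ b : ι → ℝ, Summable b ∧
      ∀ i, ∀ z ∈ ball z₀ ρ, ‖a i * monomial (e i) z‖ ≤ b i := by
  have hopen : IsOpen (U ∩ ⋂ j, {z : Fin n → ℂ | z₀ j = 0 ∨ z j ≠ 0}) := by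
    refine hU.inter (isOpen_iInter_of_finite fun j => ?_)
    by_cases h0 : z₀ j = 0
    · simp [h0]
    · simpa [h0] using isOpen_ne_fun (continuous_apply j) continuous_const
  obtain ⟨δ, hδ, hball⟩ := Metric.isOpen_iff.1 hopen z₀
    ⟨hz₀, mem_iInter.2 fun j => em (z₀ j = 0)⟩
  have hlarge : ∀ j, z₀ j ≠ 0 → δ ≤ ‖z₀ j‖ := by
    intro j hj
    by_contra hlt
    push Not at hlt
    have hmem : Function.update z₀ j 0 ∈ ball z₀ δ := by
      rw [mem_ball, dist_pi_lt_iff hδ]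
      intro i
      rcases eq_or_ne i j with rfl | hij
      · simpa using hlt
      · simpa [hij] using hδ
    rcases mem_iInter.1 (hball hmem).2 j with h | h
    · exact hj h
    · simp at h
  set ρ := δ / 2 with hρ
  have hρ0 : 0 < ρ := by positivity
  -- `p s` is the corner whose `j`-th modulus is `|z₀ j| + ρ` if `s j`, else `|z₀ j| - ρ` (or `0`).
  set p : (Fin n → Bool) → Fin n → ℂ := fun s j =>
    if z₀ j = 0 then (if s j then (ρ : ℂ) else 0)
    else z₀ j * (1 + (if s j then 1 else -1) * (ρ / ‖z₀ j‖ : ℝ)) with hp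
  have hpU : ∀ s, p s ∈ U := by
    intro s
    refine (hball ?_).1
    rw [mem_ball, dist_pi_lt_iff hδ]
    intro j
    rw [dist_eq_norm]
    by_cases hj : z₀ j = 0
    · cases hs : s j <;> simp [hp, hj, hs, abs_of_pos hρ0, hδ]
      linarith
    · have hj' : (‖z₀ j‖ : ℝ) ≠ 0 := norm_ne_zero_iff.2 hj
      have h1 : p s j - z₀ j = z₀ j * ((if s j then 1 else -1) * (ρ / ‖z₀ j‖ : ℝ)) := by
        simp only [hp, hj, if_false]
        ring
      have h2 : ‖((if s j then 1 else -1 : ℂ))‖ = 1 := by split_ifs <;> simp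
      rw [h1, norm_mul, norm_mul, h2, Complex.norm_real, Real.norm_of_nonneg (by positivity)]
      field_simp
      linarith
  have hfactor : ∀ z ∈ ball z₀ ρ, ∀ (j : Fin n) (k : ℤ), (z₀ j = 0 → 0 ≤ k) →
      ‖z j‖ ^ k ≤ ∑ s : Bool, ‖p (fun _ => s) j‖ ^ k := by
    intro z hz j k hk
    have hzj : ‖z j - z₀ j‖ < ρ := by
      rw [← dist_eq_norm]
      exact (dist_le_pi_dist z z₀ j).trans_lt hz
    rw [Fintype.sum_bool]
    have hupper : ‖p (fun _ => true) j‖ = ‖z₀ j‖ + ρ := by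
      by_cases hj : z₀ j = 0
      · simp [hp, hj, abs_of_pos hρ0]
      · have hj' : (‖z₀ j‖ : ℝ) ≠ 0 := norm_ne_zero_iff.2 hj
        have : p (fun _ => true) j = z₀ j * ((1 + ρ / ‖z₀ j‖ : ℝ) : ℂ) := by
          simp [hp, hj]
        rw [this, norm_mul, Complex.norm_real, Real.norm_of_nonneg (by positivity)]
        field_simp
    by_cases hk0 : 0 ≤ k
    · refine le_add_of_le_of_nonneg ?_ (by positivity)
      rw [hupper]
      refine zpow_le_zpow_left₀ hk0 (norm_nonneg _) ?_
      have := norm_le_norm_add_norm_sub' (z j) (z₀ j)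
      linarith
    · have hj : z₀ j ≠ 0 := fun h => hk0 (hk h)
      have hj' : (‖z₀ j‖ : ℝ) ≠ 0 := norm_ne_zero_iff.2 hj
      have hjδ := hlarge j hj
      have hlower : ‖p (fun _ => false) j‖ = ‖z₀ j‖ - ρ := by
        have : p (fun _ => false) j = z₀ j * ((1 - ρ / ‖z₀ j‖ : ℝ) : ℂ) := by
          simp [hp, hj, sub_eq_add_neg]
        have hle : ρ / ‖z₀ j‖ ≤ 1 := by
          rw [div_le_one (norm_pos_iff.2 hj)]
          linarith
        rw [this, norm_mul, Complex.norm_real, Real.norm_of_nonneg (by linarith)]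
        field_simp
      refine le_add_of_nonneg_of_le (by positivity) ?_
      rw [hlower]
      obtain ⟨m, rfl⟩ : ∃ m : ℕ, k = -m := ⟨k.natAbs, by omega⟩
      rw [zpow_neg, zpow_neg, zpow_natCast, zpow_natCast]
      have hpos : 0 < ‖z₀ j‖ - ρ := by linarith
      refine inv_anti₀ (by positivity) (pow_le_pow_left₀ hpos.le ?_ m)
      have := norm_le_norm_add_norm_sub (z j) (z₀ j)
      linarith
  refine ⟨ρ, hρ0, fun z hz => (hball (ball_subset_ball (by linarith) hz)).1,
    fun i => ∑ s, ‖a i * monomial (e i) (p s)‖,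
    summable_sum fun s _ => ha _ (hpU s), fun i z hz => ?_⟩
  by_cases hai : a i = 0
  · simp [hai]
  simp_rw [norm_mul]
  rw [← Finset.mul_sum]
  refine mul_le_mul_of_nonneg_left ?_ (norm_nonneg _)
  simp_rw [norm_monomial]
  calc ∏ j, ‖z j‖ ^ e i j
      ≤ ∏ j, ∑ s : Bool, ‖p (fun _ => s) j‖ ^ e i j :=
        Finset.prod_le_prod (fun j _ => by positivity) fun j _ =>
          hfactor z hz j (e i j) (hreg i hai z₀ hz₀ j)
    _ = ∑ s : Fin n → Bool, ∏ j, ‖p s j‖ ^ e i j := by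
        rw [Finset.prod_univ_sum, Fintype.piFinset_univ]

theorem differentiableOn_tsum_monomial {U : Set (Fin n → ℂ)} (hU : IsOpen U) {ι : Type*}
    {e : ι → Fin n → ℤ} {a : ι → ℂ}
    (ha : ∀ z ∈ U, Summable fun i => ‖a i * monomial (e i) z‖)
    (hreg : ∀ i, a i ≠ 0 → IsRegularOn (e i) U) :
    DifferentiableOn ℂ (fun z => ∑' i, a i * monomial (e i) z) U := by
  intro z₀ hz₀
  obtain ⟨ρ, hρ, hρU, b, hb, hbound⟩ := exists_summable_bound_of_summable hU ha hreg hz₀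
  refine (differentiableAt_tsum_of_norm_le hρ hb (fun i => ?_) hbound).differentiableWithinAt
  by_cases hai : a i = 0
  · simp [hai]
  · exact ((hreg i hai).differentiableOn.mono hρU).const_mul _

end LaurentSeries

/-! ### Products of points of a Reinhardt domain -/

section Reinhardt

variable {Ω : Set (Fin n → ℂ)}

theorem isOpenMap_mul_complex : IsOpenMap fun x : ℂ × ℂ => x.1 * x.2 := by
  rw [isOpenMap_iff_nhds_le]
  rintro ⟨a, b⟩
  have hr : ∀ a b : ℂ, b ≠ 0 → 𝓝 (a * b) ≤ map (fun x => x * b) (𝓝 a) := fun a b hb =>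
    (Homeomorph.mulRight₀ b hb).isOpenMap.nhds_le a
  by_cases hb : b = 0
  · by_cases ha : a = 0
    · subst ha hb
      intro s hs
      rw [mem_map, nhds_prod_eq, mem_prod_iff] at hs
      obtain ⟨s₁, h₁, s₂, h₂, hs⟩ := hs
      obtain ⟨ε, hε, hε'⟩ := Metric.mem_nhds_iff.1 (inter_mem h₁ h₂)
      set δ := ε / 2 with hδ
      have hδ0 : 0 < δ := by positivity
      simp only [mul_zero]
      refine mem_of_superset (ball_mem_nhds 0 (by positivity : 0 < δ * δ)) fun x hx => ?_
      have hx1 : x / δ ∈ ball (0 : ℂ) ε := by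
        rw [mem_ball_zero_iff, norm_div, Complex.norm_real, Real.norm_of_nonneg hδ0.le,
          div_lt_iff₀ hδ0]
        rw [mem_ball_zero_iff] at hx
        nlinarith
      have hx2 : (δ : ℂ) ∈ ball (0 : ℂ) ε := by
        rw [mem_ball_zero_iff, Complex.norm_real, Real.norm_of_nonneg hδ0.le]
        linarith
      have : ((x / δ, (δ : ℂ)) : ℂ × ℂ) ∈ s₁ ×ˢ s₂ := ⟨(hε' hx1).1, (hε' hx2).2⟩
      have := hs this
      have hδ' : (δ : ℂ) ≠ 0 := by exact_mod_cast hδ0.ne'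
      simpa [div_mul_cancel₀ _ hδ'] using this
    · have h1 : 𝓝 (b * a) ≤ map (fun x => x * a) (𝓝 b) := hr b a ha
      have h2 : map (fun x => x * a) (𝓝 b) ≤ map (fun x : ℂ × ℂ => x.1 * x.2) (𝓝 (a, b)) := by
        have : (fun x => x * a) = (fun x : ℂ × ℂ => x.1 * x.2) ∘ fun x => (a, x) := by
          funext x
          simp [mul_comm]
        rw [this, ← map_map]
        exact map_mono (Continuous.tendsto (by fun_prop) b)
      simpa [mul_comm] using h1.trans h2
  · refine (hr a b hb).trans ?_
    have : (fun x => x * b) = (fun x : ℂ × ℂ => x.1 * x.2) ∘ fun x => (x, b) := rfl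
    rw [this, ← map_map]
    exact map_mono (Continuous.tendsto (by fun_prop) a)

theorem isOpen_conjProduct (hΩ : IsOpen Ω) : IsOpen (conjProduct Ω) := by
  have hpi : IsOpenMap (Pi.map fun (_ : Fin n) (x : ℂ × ℂ) => x.1 * x.2) :=
    IsOpenMap.piMap (fun _ => isOpenMap_mul_complex) (by simp)
  have hS : IsOpen {x : Fin n → ℂ × ℂ | (fun j => (x j).1) ∈ Ω ∧ (fun j => star (x j).2) ∈ Ω} :=
    (hΩ.preimage (by fun_prop)).inter (hΩ.preimage (by fun_prop))
  convert hpi _ hS using 1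
  ext ζ
  constructor
  · rintro ⟨z, hz, w, hw, rfl⟩
    exact ⟨fun j => (z j, star (w j)), ⟨hz, by simpa using hw⟩, rfl⟩
  · rintro ⟨x, ⟨h1, h2⟩, rfl⟩
    exact ⟨_, h1, _, h2, by funext j; simp [Pi.map]⟩

theorem IsRegularOn.conjProduct {α : Fin n → ℤ} (h : IsRegularOn α Ω) :
    IsRegularOn α (conjProduct Ω) := by
  rintro ζ ⟨z, hz, w, hw, rfl⟩ j hj
  rcases mul_eq_zero.1 hj with h0 | h0
  · exact h z hz j h0
  · exact h w hw j (by simpa using h0)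

theorem IsReinhardtDomain.norm_mem (hΩ : IsReinhardtDomain Ω) {z : Fin n → ℂ} (hz : z ∈ Ω) :
    (fun j => (‖z j‖ : ℂ)) ∈ Ω := by
  have := hΩ.rotate_mem (fun j => if z j = 0 then 1 else ‖z j‖ / z j) (fun j => by
    by_cases hj : z j = 0 <;> simp [hj]) z hz
  convert this using 1
  funext j
  by_cases hj : z j = 0 <;> simp [hj]

end Reinhardt

/-! ### Averages over the torus -/

section Torus

/-- The normalised Haar measure of the torus `(ℝ/ℤ)ⁿ`. -/
noncomputable def torusMeasure (n : ℕ) : Measure (UnitAddTorus (Fin n)) :=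
  Measure.pi fun _ => AddCircle.haarAddCircle

instance : IsProbabilityMeasure (torusMeasure n) := by
  unfold torusMeasure; infer_instance

instance : (torusMeasure n).IsAddHaarMeasure := by
  unfold torusMeasure; infer_instance

theorem mFourierCoeff_eq (f : UnitAddTorus (Fin n) → ℂ) (α : Fin n → ℤ) :
    mFourierCoeff f α = ∫ θ, mFourier (-α) θ * f θ ∂torusMeasure n := rfl

theorem norm_mFourier_apply (α : Fin n → ℤ) (θ : UnitAddTorus (Fin n)) :
    ‖mFourier α θ‖ = 1 := by
  simp only [mFourier, fourier_apply, ContinuousMap.coe_mk, norm_prod]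
  exact Finset.prod_eq_one fun j _ => Circle.norm_coe _

theorem integral_mFourier_mul_mFourier (α β : Fin n → ℤ) :
    ∫ θ, mFourier (-α) θ * mFourier β θ ∂torusMeasure n = if α = β then 1 else 0 := by
  have := orthonormal_iff_ite.1 (orthonormal_mFourier (d := Fin n)) α β
  rw [← this, ContinuousMap.inner_toLp]
  simp_rw [mFourier_neg, mul_comm]
  rfl

theorem mFourierCoeff_of_hasSum {a : (Fin n → ℤ) → ℂ} (ha : Summable fun β => ‖a β‖)
    {f : UnitAddTorus (Fin n) → ℂ} (hf : ∀ θ, HasSum (fun β => a β * mFourier β θ) (f θ))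
    (α : Fin n → ℤ) : mFourierCoeff f α = a α := by
  have hint : ∀ β, Integrable (fun θ => mFourier (-α) θ * (a β * mFourier β θ))
      (torusMeasure n) := fun β =>
    Continuous.integrable_of_hasCompactSupport (by fun_prop) (HasCompactSupport.of_compactSpace _)
  have hnorm : ∀ β, ∫ θ, ‖mFourier (-α) θ * (a β * mFourier β θ)‖ ∂torusMeasure n = ‖a β‖ := by
    intro β
    simp [norm_mFourier_apply]
  have := hasSum_integral_of_summable_integral_norm hint (by simpa only [hnorm] using ha)
  have hval : ∀ β, ∫ θ, mFourier (-α) θ * (a β * mFourier β θ) ∂torusMeasure n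
      = if β = α then a α else 0 := by
    intro β
    simp_rw [mul_left_comm _ (a β)]
    rw [integral_const_mul, integral_mFourier_mul_mFourier]
    by_cases h : α = β
    · simp [h]
    · simp [h, Ne.symm h]
  simp_rw [hval] at this
  rw [mFourierCoeff_eq]
  refine Eq.trans ?_ (this.unique (hasSum_ite_eq α (a α)))
  refine integral_congr_ae (ae_of_all _ fun θ => ?_)
  dsimp only
  rw [tsum_mul_left, (hf θ).tsum_eq]

/-- The point `(e^{2πiθ₁}, …, e^{2πiθₙ})` of `ℂⁿ`. -/
noncomputable def torusPoint (θ : UnitAddTorus (Fin n)) : Fin n → ℂ :=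
  fun j => (AddCircle.toCircle (θ j) : ℂ)

theorem continuous_torusPoint : Continuous (torusPoint (n := n)) := by
  unfold torusPoint
  refine continuous_pi fun j => ?_
  exact continuous_subtype_val.comp (AddCircle.continuous_toCircle.comp (continuous_apply j))

theorem norm_torusPoint (θ : UnitAddTorus (Fin n)) (j : Fin n) : ‖torusPoint θ j‖ = 1 :=
  Circle.norm_coe _

theorem torusPoint_add (θ τ : UnitAddTorus (Fin n)) :
    torusPoint (θ + τ) = torusPoint θ * torusPoint τ := by
  funext j
  simp [torusPoint, AddCircle.toCircle_add]

theorem torusPoint_zero : torusPoint (0 : UnitAddTorus (Fin n)) = 1 := by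
  funext j
  simp [torusPoint]

theorem monomial_torusPoint (α : Fin n → ℤ) (θ : UnitAddTorus (Fin n)) :
    monomial α (torusPoint θ) = mFourier α θ := by
  simp [monomial, torusPoint, mFourier, fourier_apply, AddCircle.toCircle_zsmul]

theorem torusPoint_coe (x : Fin n → ℝ) :
    torusPoint (fun j => (x j : UnitAddCircle)) =
      fun j => Complex.exp (2 * Real.pi * Complex.I * (x j : ℂ)) := by
  funext j
  simp only [torusPoint, AddCircle.toCircle_apply_mk, Circle.coe_exp]
  congr 1
  push_cast
  ring

theorem exists_torusPoint_eq {t : Fin n → ℂ} (ht : ∀ j, ‖t j‖ = 1) :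
    ∃ τ : UnitAddTorus (Fin n), torusPoint τ = t := by
  refine ⟨fun j => ((Complex.arg (t j) / (2 * Real.pi) : ℝ) : UnitAddCircle), ?_⟩
  rw [torusPoint_coe]
  funext j
  have h1 := Complex.norm_mul_exp_arg_mul_I (t j)
  rw [ht j, Complex.ofReal_one, one_mul] at h1
  rw [← h1]
  congr 1
  have : (Real.pi : ℂ) ≠ 0 := by exact_mod_cast Real.pi_ne_zero
  rw [h1]
  push_cast
  field_simp

/-- The component of multidegree `α` of `f`: the average of `f(t z) t ^ (-α)` over `t ∈ 𝕋ⁿ`. -/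
noncomputable def homogeneousPart (α : Fin n → ℤ) (f : (Fin n → ℂ) → ℂ) (z : Fin n → ℂ) : ℂ :=
  mFourierCoeff (fun θ => f (torusPoint θ * z)) α

theorem homogeneousPart_eq_integral (α : Fin n → ℤ) (f : (Fin n → ℂ) → ℂ) (z : Fin n → ℂ) :
    homogeneousPart α f z =
      ∫ θ, mFourier (-α) θ * f (torusPoint θ * z) ∂torusMeasure n := rfl

theorem homogeneousPart_rotate (α : Fin n → ℤ) (f : (Fin n → ℂ) → ℂ) {t : Fin n → ℂ}
    (ht : ∀ j, ‖t j‖ = 1) (z : Fin n → ℂ) :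
    homogeneousPart α f (t * z) = monomial α t * homogeneousPart α f z := by
  obtain ⟨τ, rfl⟩ := exists_torusPoint_eq ht
  have h := integral_add_right_eq_self (μ := torusMeasure n)
    (fun θ => mFourier (-α) (θ - τ) * f (torusPoint θ * z)) τ
  have hchar : ∀ θ, mFourier (-α) (θ - τ) = mFourier (-α) θ * mFourier α τ := by
    intro θ
    rw [← monomial_torusPoint, ← monomial_torusPoint, ← monomial_torusPoint, sub_eq_add_neg,
      torusPoint_add, monomial_mul]
    congr 1
    simp [monomial, torusPoint, AddCircle.toCircle_neg]
  simp only [add_sub_cancel_right, torusPoint_add, mul_assoc] at h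
  rw [homogeneousPart_eq_integral, h, homogeneousPart_eq_integral, ← integral_const_mul]
  refine integral_congr_ae (ae_of_all _ fun θ => ?_)
  dsimp only
  rw [hchar, monomial_torusPoint]
  ring

theorem IsReinhardtDomain.torus_mul_mem {Ω : Set (Fin n → ℂ)} (hΩ : IsReinhardtDomain Ω)
    (θ : UnitAddTorus (Fin n)) {z : Fin n → ℂ} (hz : z ∈ Ω) : torusPoint θ * z ∈ Ω :=
  hΩ.rotate_mem _ (norm_torusPoint θ) z hz

theorem IsReinhardtDomain.continuous_orbit {Ω : Set (Fin n → ℂ)} (hΩ : IsReinhardtDomain Ω)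
    {f : (Fin n → ℂ) → ℂ} (hf : DifferentiableOn ℂ f Ω) {z : Fin n → ℂ} (hz : z ∈ Ω) :
    Continuous fun θ => f (torusPoint θ * z) :=
  hf.continuousOn.comp_continuous (continuous_torusPoint.mul continuous_const)
    fun θ => hΩ.torus_mul_mem θ hz

theorem differentiableOn_homogeneousPart {Ω : Set (Fin n → ℂ)} (hΩ : IsReinhardtDomain Ω)
    {f : (Fin n → ℂ) → ℂ} (hf : DifferentiableOn ℂ f Ω) (α : Fin n → ℤ) :
    DifferentiableOn ℂ (homogeneousPart α f) Ω := by
  intro z₀ hz₀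
  obtain ⟨ρ, hρ, hball⟩ := Metric.nhds_basis_closedBall.mem_iff.1 (hΩ.isOpen.mem_nhds hz₀)
  obtain ⟨M, hM⟩ : ∃ M, ∀ θ : UnitAddTorus (Fin n), ∀ z ∈ closedBall z₀ ρ,
      ‖f (torusPoint θ * z)‖ ≤ M := by
    have hcont : ContinuousOn (fun p : UnitAddTorus (Fin n) × (Fin n → ℂ) =>
        f (torusPoint p.1 * p.2)) (univ ×ˢ closedBall z₀ ρ) :=
      hf.continuousOn.comp (by
        have := continuous_torusPoint (n := n)
        fun_prop) fun p hp => hΩ.torus_mul_mem _ (hball hp.2)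
    obtain ⟨M, hM⟩ := (isCompact_univ.prod (isCompact_closedBall z₀ ρ)).exists_bound_of_continuousOn
      hcont
    exact ⟨M, fun θ z hz => hM (θ, z) ⟨mem_univ _, hz⟩⟩
  have hdiff : ∀ θ : UnitAddTorus (Fin n), DifferentiableOn ℂ (fun z => f (torusPoint θ * z))
      (ball z₀ ρ) := fun θ =>
    hf.comp (by fun_prop) fun z hz => hΩ.torus_mul_mem θ (hball (ball_subset_closedBall hz))
  have hsub : ∀ x ∈ ball z₀ (ρ / 3), ball x (2 * (ρ / 3)) ⊆ ball z₀ ρ := by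
    intro x hx
    refine ball_subset_ball' ?_
    rw [mem_ball] at hx
    linarith
  have hz₀' : z₀ ∈ ball z₀ (ρ / 3) := mem_ball_self (by positivity)
  have hballΩ : ∀ x ∈ ball z₀ (ρ / 3), x ∈ Ω := fun x hx =>
    hball (ball_subset_closedBall (ball_subset_ball (by linarith) hx))
  have hcontF : ∀ x ∈ ball z₀ (ρ / 3), Continuous fun θ => mFourier (-α) θ * f (torusPoint θ * x) :=
    fun x hx => (mFourier (-α)).continuous.mul (hΩ.continuous_orbit hf (hballΩ x hx))
  set A : (Fin n → ℂ) →L[ℂ] (Fin n → ℂ) →L[ℂ] (Fin n → ℂ) :=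
    ContinuousLinearMap.mul ℂ (Fin n → ℂ) with hA
  have hderiv : ∀ θ : UnitAddTorus (Fin n), ∀ x ∈ ball z₀ (ρ / 3),
      HasFDerivAt (fun z => f (torusPoint θ * z))
        ((fderiv ℂ f (torusPoint θ * x)).comp (A (torusPoint θ))) x := by
    intro θ x hx
    exact ((hf.differentiableAt (hΩ.isOpen.mem_nhds
      (hΩ.torus_mul_mem θ (hballΩ x hx)))).hasFDerivAt).comp x (A (torusPoint θ)).hasFDerivAt
  refine (hasFDerivAt_integral_of_dominated_of_fderiv_le (𝕜 := ℂ) (μ := torusMeasure n)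
    (F := fun x θ => mFourier (-α) θ * f (torusPoint θ * x))
    (F' := fun x θ => mFourier (-α) θ • (fderiv ℂ f (torusPoint θ * x)).comp (A (torusPoint θ)))
    (bound := fun _ => M / (ρ / 3))
    (ball_mem_nhds z₀ (by positivity : 0 < ρ / 3)) ?_ ?_ ?_ ?_ (integrable_const _)
    ?_).differentiableAt.differentiableWithinAt
  · exact eventually_of_mem (ball_mem_nhds z₀ (by positivity : 0 < ρ / 3)) fun x hx =>
      (hcontF x hx).aestronglyMeasurable
  · exact (hcontF z₀ hz₀').integrable_of_hasCompactSupport (HasCompactSupport.of_compactSpace _)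
  · refine (mFourier (-α)).continuous.aestronglyMeasurable.smul ?_
    have h1 : Measurable fun θ : UnitAddTorus (Fin n) => fderiv ℂ f (torusPoint θ * z₀) :=
      (measurable_fderiv ℂ f).comp (continuous_torusPoint.mul continuous_const).measurable
    have h2 : Continuous fun θ : UnitAddTorus (Fin n) => A (torusPoint θ) :=
      A.continuous.comp continuous_torusPoint
    exact (ContinuousLinearMap.compL ℂ (Fin n → ℂ) (Fin n → ℂ) ℂ).aestronglyMeasurable_comp₂
      h1.stronglyMeasurable.aestronglyMeasurable h2.aestronglyMeasurable
  · refine ae_of_all _ fun θ x hx => ?_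
    rw [norm_smul, norm_mFourier_apply, one_mul, ← (hderiv θ x hx).fderiv]
    exact norm_fderiv_le_of_norm_le (by positivity) ((hdiff θ).mono (hsub x hx)) fun y hy =>
      hM θ y (ball_subset_closedBall (hsub x hx hy))
  · refine ae_of_all _ fun θ x hx => ?_
    simpa using (hderiv θ x hx).const_mul (mFourier (-α) θ)

/-- Every homogeneous component of a holomorphic function is a multiple of a monomial. -/
theorem exists_homogeneousPart_eq {Ω : Set (Fin n → ℂ)} (hΩ : IsReinhardtDomain Ω)
    {f : (Fin n → ℂ) → ℂ} (hf : DifferentiableOn ℂ f Ω) (α : Fin n → ℤ) :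
    ∃ c : ℂ, (∀ z ∈ Ω, homogeneousPart α f z = c * monomial α z) ∧ (c ≠ 0 → IsRegularOn α Ω) :=
  exists_eq_const_mul_monomial hΩ (differentiableOn_homogeneousPart hΩ hf α)
    fun _ ht z _ => homogeneousPart_rotate α f ht z

/-- The terms of any Laurent expansion are the homogeneous components, which makes it unique. -/
theorem HasLaurentExpansion.homogeneousPart_eq {Ω : Set (Fin n → ℂ)} (hΩ : IsReinhardtDomain Ω)
    {f : (Fin n → ℂ) → ℂ} {c : (Fin n → ℤ) → ℂ} (h : HasLaurentExpansion Ω f c)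
    (α : Fin n → ℤ) {z : Fin n → ℂ} (hz : z ∈ Ω) :
    homogeneousPart α f z = c α * monomial α z := by
  refine mFourierCoeff_of_hasSum (a := fun β => c β * monomial β z) (h z hz).summable.norm
    (fun θ => ?_) α
  have := h _ (hΩ.torus_mul_mem θ hz)
  simp only [monomial_mul, monomial_torusPoint] at this
  convert this using 2 with β
  ring

theorem HasLaurentExpansion.unique {Ω : Set (Fin n → ℂ)} (hΩ : IsReinhardtDomain Ω)
    {f : (Fin n → ℂ) → ℂ} {c c' : (Fin n → ℤ) → ℂ} (h : HasLaurentExpansion Ω f c)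
    (h' : HasLaurentExpansion Ω f c') : c = c' := by
  obtain ⟨z₁, hz₁⟩ := hΩ.isConnected.nonempty
  obtain ⟨p, hp, hp0⟩ := exists_mem_forall_ne_zero hΩ.isOpen hz₁
  funext α
  refine mul_right_cancel₀ (monomial_ne_zero (α := α) hp0) ?_
  rw [← h.homogeneousPart_eq hΩ α hp, h'.homogeneousPart_eq hΩ α hp]

theorem HasLaurentExpansion.laurentCoeff_eq {Ω : Set (Fin n → ℂ)} (hΩ : IsReinhardtDomain Ω)
    {f : (Fin n → ℂ) → ℂ} {c : (Fin n → ℤ) → ℂ} (h : HasLaurentExpansion Ω f c)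
    (α : Fin n → ℤ) : laurentCoeff Ω α f = c α := by
  have hex : ∃ c, HasLaurentExpansion Ω f c := ⟨c, h⟩
  rw [laurentCoeff, dif_pos hex, hex.choose_spec.unique hΩ h]

/-- A holomorphic function whose homogeneous components are absolutely summable is the sum of
its Laurent series. -/
theorem hasLaurentExpansion_of_summable {Ω : Set (Fin n → ℂ)} (hΩ : IsReinhardtDomain Ω)
    {f : (Fin n → ℂ) → ℂ} (hf : DifferentiableOn ℂ f Ω) {c : (Fin n → ℤ) → ℂ}
    (hc : ∀ α, ∀ z ∈ Ω, homogeneousPart α f z = c α * monomial α z)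
    (hs : ∀ z ∈ Ω, Summable fun α => c α * monomial α z) : HasLaurentExpansion Ω f c := by
  intro z hz
  set F : C(UnitAddTorus (Fin n), ℂ) := ⟨_, hΩ.continuous_orbit hf hz⟩ with hF
  have hcoef : mFourierCoeff F = fun α => c α * monomial α z := by
    funext α
    exact hc α z hz
  have := hasSum_mFourier_series_apply_of_summable (f := F) (by rw [hcoef]; exact hs z hz) 0
  rw [hcoef] at this
  simpa [hF, ← monomial_torusPoint, torusPoint_zero, monomial] using this

end Torus

/-! ### Rotation invariance of the weighted measure -/

section Measure

variable {Ω : Set (Fin n → ℂ)} {ω : (Fin n → ℂ) → ℝ≥0∞}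

instance : SFinite (weightMeasure Ω ω) := by
  unfold weightMeasure; infer_instance

theorem ae_mem_of_isOpen (hΩ : IsOpen Ω) : ∀ᵐ z ∂weightMeasure Ω ω, z ∈ Ω :=
  (withDensity_absolutelyContinuous _ _).ae_le (ae_restrict_mem hΩ.measurableSet)

theorem measurable_star : Measurable (star : ℂ → ℂ) :=
  continuous_star.measurable

theorem measurePreserving_mul_volume {t : Fin n → ℂ} (ht : ∀ j, ‖t j‖ = 1) :
    MeasurePreserving (fun z : Fin n → ℂ => t * z) := by
  refine volume_preserving_pi (fun j => ?_) (f := fun j (w : ℂ) => t j * w)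
  exact (rotation ⟨t j, by simp [Submonoid.unitSphere, ht j]⟩).measurePreserving

theorem mul_mem_iff (hΩ : IsReinhardtDomain Ω) {t : Fin n → ℂ} (ht : ∀ j, ‖t j‖ = 1)
    {z : Fin n → ℂ} : t * z ∈ Ω ↔ z ∈ Ω := by
  refine ⟨fun h => ?_, fun h => hΩ.rotate_mem t ht z h⟩
  have := hΩ.rotate_mem t⁻¹ (fun j => by simp [ht j]) _ h
  convert this using 1
  funext j
  have : t j ≠ 0 := fun h0 => by simpa [h0] using ht j
  simp [this]

theorem measurePreserving_mul (hΩ : IsReinhardtDomain Ω) (hω : IsMultiRadialWeight Ω ω)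
    {t : Fin n → ℂ} (ht : ∀ j, ‖t j‖ = 1) :
    MeasurePreserving (fun z : Fin n → ℂ => t * z) (weightMeasure Ω ω) (weightMeasure Ω ω) := by
  have hcont : Continuous fun z : Fin n → ℂ => t * z := by fun_prop
  have hinj : Function.Injective fun z : Fin n → ℂ => t * z := by
    intro z w h
    funext j
    have h0 : t j ≠ 0 := fun h0 => by simpa [h0] using ht j
    exact mul_left_cancel₀ h0 (congrFun h j)
  have hemb : MeasurableEmbedding fun z : Fin n → ℂ => t * z := hcont.measurableEmbedding hinj
  refine ⟨hcont.measurable, Measure.ext fun A hA => ?_⟩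
  have hval : ∀ B, MeasurableSet B →
      weightMeasure Ω ω B = ∫⁻ z, (B ∩ Ω).indicator ω z := by
    intro B hB
    rw [weightMeasure, withDensity_apply _ hB, Measure.restrict_restrict hB,
      lintegral_indicator (hB.inter hΩ.isOpen.measurableSet)]
  rw [Measure.map_apply hcont.measurable hA, hval _ hA, hval _ (hcont.measurable hA)]
  conv_rhs => rw [← (measurePreserving_mul_volume ht).lintegral_comp_emb hemb]
  refine lintegral_congr fun z => ?_
  obtain ⟨a, ha⟩ := hω.multiRadial
  by_cases hz : z ∈ Ω
  · have htz := hΩ.rotate_mem t ht z hz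
    have : ω (t * z) = ω z := by
      rw [ha _ htz, ha _ hz]
      congr 1
      funext j
      simp [ht j]
    by_cases hzA : t * z ∈ A
    · rw [indicator_of_mem (show z ∈ (fun z => t * z) ⁻¹' A ∩ Ω from ⟨hzA, hz⟩),
        indicator_of_mem (show t * z ∈ A ∩ Ω from ⟨hzA, htz⟩), this]
    · rw [indicator_of_notMem fun h => hzA h.1, indicator_of_notMem fun h => hzA h.1]
  · have htz : t * z ∉ Ω := fun h => hz ((mul_mem_iff hΩ ht).1 h)
    simp [indicator, hz, htz]

end Measure

/-! ### Homogeneous components in the weighted Bergman space -/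

section Components

variable {Ω : Set (Fin n → ℂ)} {ω : (Fin n → ℂ) → ℝ≥0∞}

theorem measurable_bergman (hΩ : IsReinhardtDomain Ω) (f : BergmanSpace Ω ω) :
    Measurable (f : (Fin n → ℂ) → ℂ) := by
  classical
  have h := ContinuousOn.measurable_piecewise (g := fun _ => (0 : ℂ)) f.2.1.continuousOn
    continuousOn_const hΩ.isOpen.measurableSet
  convert h using 1
  funext z
  by_cases hz : z ∈ Ω
  · simp [hz]
  · simp [hz, f.2.2.1 z hz]

theorem measurable_rotate (hΩ : IsReinhardtDomain Ω) (f : BergmanSpace Ω ω) :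
    Measurable fun p : UnitAddTorus (Fin n) × (Fin n → ℂ) => f.1 (torusPoint p.1 * p.2) :=
  (measurable_bergman hΩ f).comp (by
    have := (continuous_torusPoint (n := n))
    exact Continuous.measurable (by fun_prop))

/-- Averaging over the torus does not increase the `L²` norm, so a monomial occurring in the Laurent
series of an element of the Bergman space is square integrable. -/
theorem mem_allowable_of_homogeneousPart_eq (hΩ : IsReinhardtDomain Ω)
    (hω : IsMultiRadialWeight Ω ω) (f : BergmanSpace Ω ω) {α : Fin n → ℤ} {c : ℂ} (hc : c ≠ 0)
    (h : ∀ z ∈ Ω, homogeneousPart α f.1 z = c * monomial α z) : α ∈ allowable Ω ω := by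
  have hsq : ∀ {X : Type} [MeasurableSpace X] (ν : Measure X) (g : X → ℂ),
      eLpNorm g 2 ν ^ (2 : ℝ) = ∫⁻ x, ‖g x‖ₑ ^ (2 : ℝ) ∂ν := fun ν g => by
    simpa using eLpNorm_nnreal_pow_eq_lintegral (μ := ν) (f := g) (p := 2) (by norm_num)
  have hmeas := measurable_rotate hΩ f
  have hfin : ∫⁻ z, ‖f.1 z‖ₑ ^ (2 : ℝ) ∂weightMeasure Ω ω < ∞ := by
    rw [← hsq]
    exact ENNReal.rpow_lt_top_of_nonneg (by norm_num) f.2.2.2.2.ne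
  have hle : ∫⁻ z, ‖c * monomial α z‖ₑ ^ (2 : ℝ) ∂weightMeasure Ω ω
      ≤ ∫⁻ z, ‖f.1 z‖ₑ ^ (2 : ℝ) ∂weightMeasure Ω ω := by
    calc ∫⁻ z, ‖c * monomial α z‖ₑ ^ (2 : ℝ) ∂weightMeasure Ω ω
        ≤ ∫⁻ z, (∫⁻ θ, ‖f.1 (torusPoint θ * z)‖ₑ ^ (2 : ℝ) ∂torusMeasure n)
            ∂weightMeasure Ω ω := by
          refine lintegral_mono_ae ?_
          filter_upwards [ae_mem_of_isOpen (ω := ω) hΩ.isOpen] with z hz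
          have hg : AEStronglyMeasurable (fun θ => f.1 (torusPoint θ * z)) (torusMeasure n) :=
            (hΩ.continuous_orbit f.2.1 hz).aestronglyMeasurable
          rw [← h z hz, ← hsq]
          refine ENNReal.rpow_le_rpow ?_ (by norm_num)
          calc ‖homogeneousPart α f.1 z‖ₑ
              ≤ ∫⁻ θ, ‖mFourier (-α) θ * f.1 (torusPoint θ * z)‖ₑ ∂torusMeasure n :=
                enorm_integral_le_lintegral_enorm _
            _ = eLpNorm (fun θ => f.1 (torusPoint θ * z)) 1 (torusMeasure n) := by
                rw [eLpNorm_one_eq_lintegral_enorm]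
                refine lintegral_congr fun θ => ?_
                rw [enorm_mul, ← ofReal_norm (mFourier (-α) θ), norm_mFourier_apply]
                simp
            _ ≤ _ := eLpNorm_le_eLpNorm_of_exponent_le (by norm_num) hg
      _ = ∫⁻ θ, (∫⁻ z, ‖f.1 (torusPoint θ * z)‖ₑ ^ (2 : ℝ) ∂weightMeasure Ω ω)
            ∂torusMeasure n := by
          rw [lintegral_lintegral_swap]
          exact ((hmeas.comp measurable_swap).enorm.pow_const _).aemeasurable
      _ = ∫⁻ _θ, (∫⁻ z, ‖f.1 z‖ₑ ^ (2 : ℝ) ∂weightMeasure Ω ω) ∂torusMeasure n := by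
          refine lintegral_congr fun θ => ?_
          exact (measurePreserving_mul hΩ hω (norm_torusPoint θ)).lintegral_comp
            ((measurable_bergman hΩ f).enorm.pow_const _)
      _ = _ := by simp
  have hmem : MemLp (fun z => c * monomial α z) 2 (weightMeasure Ω ω) := by
    refine ⟨((measurable_monomial α).const_mul c).aestronglyMeasurable, ?_⟩
    have := hle.trans_lt hfin
    rw [← hsq] at this
    exact (ENNReal.rpow_lt_top_iff_of_pos (by norm_num)).1 this
  have := hmem.const_mul c⁻¹
  refine (memLp_congr_ae (ae_of_all _ fun z => ?_)).1 this
  simp [hc]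

/-- Against `z ^ α` only the component of multidegree `α` of `f` contributes. -/
theorem integral_star_monomial_mul (hΩ : IsReinhardtDomain Ω)
    (hω : IsMultiRadialWeight Ω ω) (f : BergmanSpace Ω ω) {α : Fin n → ℤ} {c : ℂ}
    (hα : α ∈ allowable Ω ω) (h : ∀ z ∈ Ω, homogeneousPart α f.1 z = c * monomial α z) :
    ∫ z, star (monomial α z) * f.1 z ∂weightMeasure Ω ω =
      c * ∫ z, star (monomial α z) * monomial α z ∂weightMeasure Ω ω := by
  have hint : Integrable (fun z => star (monomial α z) * f.1 z) (weightMeasure Ω ω) :=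
    MemLp.integrable_mul (p := 2) (q := 2) (MemLp.star hα) f.2.2.2
  have hrot : ∀ θ : UnitAddTorus (Fin n), ∀ z, mFourier (-α) θ *
      (star (monomial α z) * f.1 (torusPoint θ * z)) =
        star (monomial α (torusPoint θ * z)) * f.1 (torusPoint θ * z) := by
    intro θ z
    rw [monomial_mul, monomial_torusPoint, mFourier_neg, star_mul']
    simp only [starRingEnd_apply]
    ring
  have hmp := fun θ : UnitAddTorus (Fin n) => measurePreserving_mul hΩ hω (norm_torusPoint θ)
  have hmeas : Measurable fun z => star (monomial α z) * f.1 z :=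
    (measurable_star.comp (measurable_monomial α)).mul (measurable_bergman hΩ f)
  have hconst : ∀ θ : UnitAddTorus (Fin n),
      ∫ z, mFourier (-α) θ * (star (monomial α z) * f.1 (torusPoint θ * z)) ∂weightMeasure Ω ω
        = ∫ z, star (monomial α z) * f.1 z ∂weightMeasure Ω ω := by
    intro θ
    simp_rw [hrot]
    conv_rhs => rw [← (hmp θ).map_eq]
    rw [integral_map (hmp θ).measurable.aemeasurable hmeas.aestronglyMeasurable]
  have hprod : Integrable (fun p : UnitAddTorus (Fin n) × (Fin n → ℂ) =>
      mFourier (-α) p.1 * (star (monomial α p.2) * f.1 (torusPoint p.1 * p.2)))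
      ((torusMeasure n).prod (weightMeasure Ω ω)) := by
    have hm : Measurable fun p : UnitAddTorus (Fin n) × (Fin n → ℂ) =>
        mFourier (-α) p.1 * (star (monomial α p.2) * f.1 (torusPoint p.1 * p.2)) :=
      ((mFourier (-α)).continuous.measurable.comp measurable_fst).mul
        (((measurable_star.comp (measurable_monomial α)).comp measurable_snd).mul (measurable_rotate hΩ f))
    rw [integrable_prod_iff hm.aestronglyMeasurable]
    simp_rw [hrot]
    have hi : ∀ θ : UnitAddTorus (Fin n), Integrable
        (fun z => star (monomial α (torusPoint θ * z)) * f.1 (torusPoint θ * z))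
        (weightMeasure Ω ω) := fun θ => by
      have := ((hmp θ).integrable_comp hint.aestronglyMeasurable).2 hint
      simpa only [Function.comp_def] using this
    refine ⟨ae_of_all _ hi, ?_⟩
    have : ∀ θ : UnitAddTorus (Fin n),
        ∫ z, ‖star (monomial α (torusPoint θ * z)) * f.1 (torusPoint θ * z)‖ ∂weightMeasure Ω ω
          = ∫ z, ‖star (monomial α z) * f.1 z‖ ∂weightMeasure Ω ω := by
      intro θ
      conv_rhs => rw [← (hmp θ).map_eq]
      rw [integral_map (hmp θ).measurable.aemeasurable hmeas.norm.aestronglyMeasurable]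
    simp_rw [this]
    exact integrable_const _
  calc ∫ z, star (monomial α z) * f.1 z ∂weightMeasure Ω ω
      = ∫ θ, (∫ z, mFourier (-α) θ * (star (monomial α z) * f.1 (torusPoint θ * z))
          ∂weightMeasure Ω ω) ∂torusMeasure n := by
        simp_rw [hconst]
        simp
    _ = ∫ z, (∫ θ, mFourier (-α) θ * (star (monomial α z) * f.1 (torusPoint θ * z))
          ∂torusMeasure n) ∂weightMeasure Ω ω := integral_integral_swap hprod
    _ = ∫ z, c * (star (monomial α z) * monomial α z) ∂weightMeasure Ω ω := by
        refine integral_congr_ae ?_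
        filter_upwards [ae_mem_of_isOpen (ω := ω) hΩ.isOpen] with z hz
        simp_rw [mul_left_comm _ (star (monomial α z))]
        rw [integral_const_mul, ← homogeneousPart_eq_integral, h z hz]
    _ = _ := integral_const_mul _ _

end Components

/-! ### The orthonormal basis of monomials -/

section Basis

variable {Ω : Set (Fin n → ℂ)} {ω : (Fin n → ℂ) → ℝ≥0∞}

/-- The embedding of the Bergman space into `L²(Ω, ω dV)`. -/
noncomputable def toL2 : BergmanSpace Ω ω →ₗ[ℂ] Lp ℂ 2 (weightMeasure Ω ω) where
  toFun f := f.2.2.2.toLp f.1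
  map_add' f g := MemLp.toLp_add f.2.2.2 g.2.2.2
  map_smul' c f := MemLp.toLp_const_smul c f.2.2.2

theorem norm_toL2 (f : BergmanSpace Ω ω) : ‖toL2 f‖ = bergmanNorm f :=
  Lp.norm_toLp _ f.2.2.2

theorem coeFn_toL2 (f : BergmanSpace Ω ω) : toL2 f =ᵐ[weightMeasure Ω ω] f.1 :=
  MemLp.coeFn_toLp f.2.2.2

theorem inner_toLp_toL2 {F : (Fin n → ℂ) → ℂ} (hF : MemLp F 2 (weightMeasure Ω ω))
    (f : BergmanSpace Ω ω) :
    inner ℂ (hF.toLp F) (toL2 f) = ∫ z, star (F z) * f.1 z ∂weightMeasure Ω ω := by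
  rw [L2.inner_def]
  refine integral_congr_ae ?_
  filter_upwards [hF.coeFn_toLp, coeFn_toL2 f] with z h1 h2
  rw [h1, h2, RCLike.inner_apply, mul_comm]
  rfl

/-- The exponents `α` for which `z ^ α` is square integrable and holomorphic on `Ω`. They are the
exponents that occur in Laurent series of elements of the Bergman space; `allowable Ω ω` may
contain more, since a weight vanishing on `{z_j = 0}` can make a negative power of `z_j` square
integrable. -/
def holomorphicIndices (Ω : Set (Fin n → ℂ)) (ω : (Fin n → ℂ) → ℝ≥0∞) : Set (Fin n → ℤ) :=
  {α | α ∈ allowable Ω ω ∧ IsRegularOn α Ω}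

/-- The monomial `z ^ α` as an element of the Bergman space. -/
noncomputable def bergmanMonomial (hΩ : IsOpen Ω) (α : holomorphicIndices Ω ω) :
    BergmanSpace Ω ω :=
  ⟨Ω.indicator (monomial α), α.2.2.differentiableOn.congr fun _ hz => indicator_of_mem hz _,
    fun _ hz => indicator_of_notMem hz _, MemLp.indicator hΩ.measurableSet α.2.1⟩

theorem bergmanMonomial_apply (hΩ : IsOpen Ω) (α : holomorphicIndices Ω ω) {z : Fin n → ℂ}
    (hz : z ∈ Ω) : (bergmanMonomial hΩ α).1 z = monomial α z :=
  indicator_of_mem hz _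

theorem exists_homogeneousPart_coeff (hΩ : IsReinhardtDomain Ω) (hω : IsMultiRadialWeight Ω ω)
    (f : BergmanSpace Ω ω) : ∃ c : (Fin n → ℤ) → ℂ,
      (∀ α, ∀ z ∈ Ω, homogeneousPart α f.1 z = c α * monomial α z) ∧
      ∀ α, c α ≠ 0 → α ∈ holomorphicIndices Ω ω := by
  choose c hc hreg using fun α => exists_homogeneousPart_eq hΩ f.2.1 α
  exact ⟨c, hc, fun α hα =>
    ⟨mem_allowable_of_homogeneousPart_eq hΩ hω f hα (hc α), hreg α hα⟩⟩

theorem homogeneousPart_bergmanMonomial (hΩ : IsReinhardtDomain Ω)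
    (α : holomorphicIndices Ω ω) (β : Fin n → ℤ) {z : Fin n → ℂ} (hz : z ∈ Ω) :
    homogeneousPart β (bergmanMonomial hΩ.isOpen α).1 z =
      (Pi.single (α : Fin n → ℤ) (1 : ℂ) : (Fin n → ℤ) → ℂ) β * monomial β z := by
  have hexp : HasLaurentExpansion Ω (bergmanMonomial hΩ.isOpen α).1
      (Pi.single (α : Fin n → ℤ) (1 : ℂ)) := by
    intro w hw
    rw [bergmanMonomial_apply _ _ hw]
    convert hasSum_single (α : Fin n → ℤ) fun γ hγ => ?_ using 1
    · simp
    · simp [hγ]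
  exact hexp.homogeneousPart_eq hΩ β hz

theorem inner_bergmanMonomial (hΩ : IsReinhardtDomain Ω) (hω : IsMultiRadialWeight Ω ω)
    (f : BergmanSpace Ω ω) (α : holomorphicIndices Ω ω) {c : ℂ}
    (h : ∀ z ∈ Ω, homogeneousPart α f.1 z = c * monomial α z) :
    inner ℂ (toL2 (bergmanMonomial hΩ.isOpen α)) (toL2 f) =
      c * (‖toL2 (bergmanMonomial hΩ.isOpen α)‖ : ℂ) ^ 2 := by
  have key : ∀ g : BergmanSpace Ω ω, inner ℂ (toL2 (bergmanMonomial hΩ.isOpen α)) (toL2 g) =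
      ∫ z, star (monomial α z) * g.1 z ∂weightMeasure Ω ω := by
    intro g
    refine (inner_toLp_toL2 (bergmanMonomial hΩ.isOpen α).2.2.2 g).trans (integral_congr_ae ?_)
    filter_upwards [ae_mem_of_isOpen (ω := ω) hΩ.isOpen] with z hz
    rw [bergmanMonomial_apply _ _ hz]
  have hself : (‖toL2 (bergmanMonomial hΩ.isOpen α)‖ : ℂ) ^ 2 =
      ∫ z, star (monomial α z) * monomial α z ∂weightMeasure Ω ω := by
    have := inner_self_eq_norm_sq_to_K (𝕜 := ℂ) (toL2 (bergmanMonomial hΩ.isOpen α))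
    refine this.symm.trans ((key _).trans (integral_congr_ae ?_))
    filter_upwards [ae_mem_of_isOpen (ω := ω) hΩ.isOpen] with z hz
    rw [bergmanMonomial_apply _ _ hz]
  rw [key, hself, integral_star_monomial_mul hΩ hω f α.2.1 h]

theorem norm_bergmanMonomial_pos (hΩ : IsReinhardtDomain Ω) (hadm : IsAdmissible Ω ω)
    (α : holomorphicIndices Ω ω) : 0 < ‖toL2 (bergmanMonomial hΩ.isOpen α)‖ := by
  obtain ⟨z₁, hz₁⟩ := hΩ.isConnected.nonempty
  obtain ⟨p, hp, hp0⟩ := exists_mem_forall_ne_zero hΩ.isOpen hz₁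
  obtain ⟨C, hC, h⟩ := hadm {p} isCompact_singleton (by simpa using hp)
  have := h (bergmanMonomial hΩ.isOpen α) p rfl
  rw [bergmanMonomial_apply _ _ hp, ← norm_toL2] at this
  have hpos : 0 < ‖monomial (α : Fin n → ℤ) p‖ := norm_pos_iff.2 (monomial_ne_zero hp0)
  exact pos_of_mul_pos_right (hpos.trans_le this) hC.le

/-- The normalised monomial `z ^ α / ‖z ^ α‖`. -/
noncomputable def basisElt (hΩ : IsOpen Ω) (α : holomorphicIndices Ω ω) : BergmanSpace Ω ω :=
  ((‖toL2 (bergmanMonomial hΩ α)‖⁻¹ : ℝ) : ℂ) • bergmanMonomial hΩ α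

theorem toL2_basisElt (hΩ : IsOpen Ω) (α : holomorphicIndices Ω ω) :
    toL2 (basisElt hΩ α) =
      ((‖toL2 (bergmanMonomial hΩ α)‖⁻¹ : ℝ) : ℂ) • toL2 (bergmanMonomial hΩ α) :=
  map_smul _ _ _

theorem basisElt_apply (hΩ : IsOpen Ω) (α : holomorphicIndices Ω ω) {z : Fin n → ℂ}
    (hz : z ∈ Ω) : (basisElt hΩ α).1 z =
      ((‖toL2 (bergmanMonomial hΩ α)‖⁻¹ : ℝ) : ℂ) * monomial α z := by
  rw [← bergmanMonomial_apply hΩ α hz]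
  rfl

theorem inner_basisElt (hΩ : IsReinhardtDomain Ω) (hω : IsMultiRadialWeight Ω ω)
    (f : BergmanSpace Ω ω) (α : holomorphicIndices Ω ω) {c : ℂ}
    (h : ∀ z ∈ Ω, homogeneousPart α f.1 z = c * monomial α z) :
    inner ℂ (toL2 (basisElt hΩ.isOpen α)) (toL2 f) =
      c * ‖toL2 (bergmanMonomial hΩ.isOpen α)‖ := by
  rw [toL2_basisElt, inner_smul_left, inner_bergmanMonomial hΩ hω f α h, Complex.conj_ofReal]
  by_cases h0 : (‖toL2 (bergmanMonomial hΩ.isOpen α)‖ : ℂ) = 0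
  · simp [h0]
  · push_cast
    field_simp

theorem orthonormal_basisElt (hΩ : IsReinhardtDomain Ω) (hω : IsMultiRadialWeight Ω ω)
    (hadm : IsAdmissible Ω ω) :
    Orthonormal ℂ fun α : holomorphicIndices Ω ω => toL2 (basisElt hΩ.isOpen α) := by
  refine ⟨fun α => ?_, fun α β hαβ => ?_⟩
  · dsimp only
    rw [toL2_basisElt, norm_smul, Complex.norm_real, norm_inv, norm_norm,
      inv_mul_cancel₀ (norm_bergmanMonomial_pos hΩ hadm α).ne']
  · have h0 : inner ℂ (toL2 (basisElt hΩ.isOpen α)) (toL2 (bergmanMonomial hΩ.isOpen β)) = 0 := by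
      rw [inner_basisElt hΩ hω _ α fun z hz => homogeneousPart_bergmanMonomial hΩ β α hz,
        Pi.single_eq_of_ne (fun h => hαβ (Subtype.ext h)), zero_mul]
    dsimp only
    rw [toL2_basisElt hΩ.isOpen β, inner_smul_right, h0, mul_zero]

/-- The diagonal of the Bergman kernel is finite. -/
theorem summable_sq_basisElt (hΩ : IsReinhardtDomain Ω) (hω : IsMultiRadialWeight Ω ω)
    (hadm : IsAdmissible Ω ω) {z : Fin n → ℂ} (hz : z ∈ Ω) :
    Summable fun α : holomorphicIndices Ω ω => ‖(basisElt hΩ.isOpen α).1 z‖ ^ 2 := by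
  obtain ⟨C, hC, h⟩ := hadm {z} isCompact_singleton (by simpa using hz)
  refine summable_of_sum_le (c := C ^ 2) (fun α => by positivity) fun s => ?_
  set S := ∑ α ∈ s, ‖(basisElt hΩ.isOpen α).1 z‖ ^ 2 with hS
  have hS0 : 0 ≤ S := Finset.sum_nonneg fun α _ => by positivity
  -- Evaluate at `z` the element of the span that represents evaluation at `z`.
  set p : BergmanSpace Ω ω :=
    ∑ α ∈ s, star ((basisElt hΩ.isOpen α).1 z) • basisElt hΩ.isOpen α with hp
  have hpz : p.1 z = (S : ℂ) := by
    rw [hp, hS]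
    push_cast
    rw [Finset.sum_apply]
    refine Finset.sum_congr rfl fun α _ => ?_
    rw [← Complex.conj_mul']
    rfl
  have hpn : ‖toL2 p‖ ^ 2 = S := by
    have h1 := inner_self_eq_norm_sq_to_K (𝕜 := ℂ) (toL2 p)
    have h2 : inner ℂ (toL2 p) (toL2 p) = (S : ℂ) := by
      rw [hp, map_sum]
      simp_rw [map_smul]
      rw [(orthonormal_basisElt hΩ hω hadm).inner_sum, hS]
      push_cast
      refine Finset.sum_congr rfl fun α _ => ?_
      rw [← Complex.conj_mul']
      simp [mul_comm]
    rw [h2] at h1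
    refine Complex.ofReal_injective ?_
    rw [h1]
    push_cast
    rfl
  have := h p z rfl
  rw [hpz, ← norm_toL2, Complex.norm_real, Real.norm_of_nonneg hS0] at this
  have h3 : S ^ 2 ≤ C ^ 2 * S := by
    calc S ^ 2 ≤ (C * ‖toL2 p‖) ^ 2 := pow_le_pow_left₀ hS0 this 2
      _ = C ^ 2 * S := by rw [mul_pow, hpn]
  rcases hS0.eq_or_lt with h0 | h0
  · rw [← h0]; positivity
  · rw [sq S] at h3
    exact le_of_mul_le_mul_right h3 h0

theorem summable_mul_of_summable_sq {ι : Type*} {a b : ι → ℂ} (ha : Summable fun i => ‖a i‖ ^ 2)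
    (hb : Summable fun i => ‖b i‖ ^ 2) : Summable fun i => ‖a i * b i‖ := by
  refine Summable.of_nonneg_of_le (fun i => norm_nonneg _) (fun i => ?_) (ha.add hb)
  rw [norm_mul]
  nlinarith [sq_nonneg (‖a i‖ - ‖b i‖), sq_nonneg (‖a i‖), sq_nonneg (‖b i‖)]

/-- The Laurent term `c z ^ α` of `f` is the component of `f` along the `α`-th normalised monomial. -/
theorem homogeneousPart_eq_inner (hΩ : IsReinhardtDomain Ω) (hω : IsMultiRadialWeight Ω ω)
    (hadm : IsAdmissible Ω ω) (f : BergmanSpace Ω ω) (α : holomorphicIndices Ω ω)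
    {c : ℂ} (h : ∀ z ∈ Ω, homogeneousPart α f.1 z = c * monomial α z) {z : Fin n → ℂ}
    (hz : z ∈ Ω) : c * monomial α z =
      inner ℂ (toL2 (basisElt hΩ.isOpen α)) (toL2 f) * (basisElt hΩ.isOpen α).1 z := by
  have hN : (‖toL2 (bergmanMonomial hΩ.isOpen α)‖ : ℂ) ≠ 0 := by
    exact_mod_cast (norm_bergmanMonomial_pos hΩ hadm α).ne'
  rw [inner_basisElt hΩ hω f α h, basisElt_apply _ _ hz]
  push_cast
  field_simp

/-- The Laurent series of `f` converges absolutely on `Ω` to `f`: by Bessel's inequality and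
finiteness of the Bergman kernel it converges absolutely, and its sum is `f` because both have the
same Fourier coefficients on every torus. -/
theorem hasLaurentExpansion_laurentCoeff (hΩ : IsReinhardtDomain Ω)
    (hω : IsMultiRadialWeight Ω ω) (hadm : IsAdmissible Ω ω) (f : BergmanSpace Ω ω) :
    HasLaurentExpansion Ω f.1 (fun α => laurentCoeff Ω α f.1) := by
  obtain ⟨c, hc, hind⟩ := exists_homogeneousPart_coeff hΩ hω f
  have hexp : HasLaurentExpansion Ω f.1 c := by
    refine hasLaurentExpansion_of_summable hΩ f.2.1 hc fun z hz => ?_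
    have h1 : Summable fun α : holomorphicIndices Ω ω => c α * monomial α z := by
      have h2 := summable_mul_of_summable_sq
        ((orthonormal_basisElt hΩ hω hadm).inner_products_summable (toL2 f))
        (summable_sq_basisElt hΩ hω hadm hz)
      refine h2.of_norm.congr fun α => ?_
      exact (homogeneousPart_eq_inner hΩ hω hadm f α (hc α) hz).symm
    refine (Function.Injective.summable_iff Subtype.val_injective fun α hα => ?_).1 h1
    have : c α = 0 := by
      by_contra h0
      exact hα ⟨⟨α, hind α h0⟩, rfl⟩
    simp [this]
  convert hexp using 1
  funext α
  exact hexp.laurentCoeff_eq hΩ α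

theorem laurentCoeff_eq_zero (hΩ : IsReinhardtDomain Ω)
    (hω : IsMultiRadialWeight Ω ω) (hadm : IsAdmissible Ω ω) (f : BergmanSpace Ω ω)
    {α : Fin n → ℤ} (hα : α ∉ holomorphicIndices Ω ω) : laurentCoeff Ω α f.1 = 0 := by
  obtain ⟨c, hc, hind⟩ := exists_homogeneousPart_coeff hΩ hω f
  obtain ⟨z₁, hz₁⟩ := hΩ.isConnected.nonempty
  obtain ⟨p, hp, hp0⟩ := exists_mem_forall_ne_zero hΩ.isOpen hz₁
  have h1 := (hasLaurentExpansion_laurentCoeff hΩ hω hadm f).homogeneousPart_eq hΩ α hp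
  have h0 : c α = 0 := by
    by_contra h0
    exact hα (hind α h0)
  rw [hc α p hp, h0, zero_mul] at h1
  exact (mul_eq_zero.1 h1.symm).resolve_right (monomial_ne_zero hp0)

theorem inner_basisElt_eq_laurentCoeff (hΩ : IsReinhardtDomain Ω)
    (hω : IsMultiRadialWeight Ω ω) (hadm : IsAdmissible Ω ω) (f : BergmanSpace Ω ω)
    (α : holomorphicIndices Ω ω) :
    inner ℂ (toL2 (basisElt hΩ.isOpen α)) (toL2 f) =
      laurentCoeff Ω α f.1 * ‖toL2 (bergmanMonomial hΩ.isOpen α)‖ :=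
  inner_basisElt hΩ hω f α fun _ hz =>
    (hasLaurentExpansion_laurentCoeff hΩ hω hadm f).homogeneousPart_eq hΩ α hz

theorem hasSum_inner_mul_basisElt (hΩ : IsReinhardtDomain Ω)
    (hω : IsMultiRadialWeight Ω ω) (hadm : IsAdmissible Ω ω) (f : BergmanSpace Ω ω)
    {z : Fin n → ℂ} (hz : z ∈ Ω) :
    HasSum (fun α : holomorphicIndices Ω ω =>
      inner ℂ (toL2 (basisElt hΩ.isOpen α)) (toL2 f) * (basisElt hΩ.isOpen α).1 z) (f.1 z) := by
  have hexp := hasLaurentExpansion_laurentCoeff hΩ hω hadm f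
  have h1 : HasSum (fun α : holomorphicIndices Ω ω =>
      laurentCoeff Ω (α : Fin n → ℤ) f.1 * monomial α z) (f.1 z) := by
    refine (Function.Injective.hasSum_iff Subtype.val_injective fun α hα => ?_).2 (hexp z hz)
    dsimp only
    rw [laurentCoeff_eq_zero hΩ hω hadm f (by simpa using hα), zero_mul]
  refine h1.congr_fun fun α => ?_
  exact (homogeneousPart_eq_inner hΩ hω hadm f α
    (fun w hw => hexp.homogeneousPart_eq hΩ α hw) hz).symm

theorem coeffNorm_eq_zero (hΩ : IsReinhardtDomain Ω) (hω : IsMultiRadialWeight Ω ω)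
    (hadm : IsAdmissible Ω ω) {α : Fin n → ℤ} (hα : α ∉ holomorphicIndices Ω ω) :
    coeffNorm Ω ω α = 0 := by
  refine le_antisymm (csInf_le ⟨0, fun C hC => hC.1⟩ ⟨le_rfl, fun f => ?_⟩)
    (Real.sInf_nonneg fun C hC => hC.1)
  simp [laurentCoeff_eq_zero hΩ hω hadm f hα]

theorem coeffNorm_eq_inv (hΩ : IsReinhardtDomain Ω) (hω : IsMultiRadialWeight Ω ω)
    (hadm : IsAdmissible Ω ω) (α : holomorphicIndices Ω ω) :
    coeffNorm Ω ω α = ‖toL2 (bergmanMonomial hΩ.isOpen α)‖⁻¹ := by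
  have hN := norm_bergmanMonomial_pos hΩ hadm α
  have hmem : ‖toL2 (bergmanMonomial hΩ.isOpen α)‖⁻¹ ∈ {C : ℝ | 0 ≤ C ∧
      ∀ f : BergmanSpace Ω ω, ‖laurentCoeff Ω α f.1‖ ≤ C * bergmanNorm f} := by
    refine ⟨by positivity, fun f => ?_⟩
    have h1 := norm_inner_le_norm (𝕜 := ℂ) (toL2 (basisElt hΩ.isOpen α)) (toL2 f)
    rw [(orthonormal_basisElt hΩ hω hadm).1 α, one_mul,
      inner_basisElt_eq_laurentCoeff hΩ hω hadm, norm_mul, Complex.norm_real, norm_norm,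
      norm_toL2 f] at h1
    rw [inv_mul_eq_div, le_div_iff₀ hN]
    exact h1
  refine le_antisymm (csInf_le ⟨0, fun C hC => hC.1⟩ hmem) (le_csInf ⟨_, hmem⟩ ?_)
  rintro C ⟨hC0, hC⟩
  have h1 := hC (bergmanMonomial hΩ.isOpen α)
  have hexp := hasLaurentExpansion_laurentCoeff hΩ hω hadm (bergmanMonomial hΩ.isOpen α)
  obtain ⟨z₁, hz₁⟩ := hΩ.isConnected.nonempty
  obtain ⟨p, hp, hp0⟩ := exists_mem_forall_ne_zero hΩ.isOpen hz₁
  have h2 : laurentCoeff Ω α (bergmanMonomial hΩ.isOpen α).1 = 1 := by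
    have h3 := hexp.homogeneousPart_eq hΩ α hp
    rw [homogeneousPart_bergmanMonomial hΩ α α hp, Pi.single_eq_same] at h3
    exact (mul_right_cancel₀ (monomial_ne_zero hp0) h3).symm
  rw [h2, norm_one, ← norm_toL2] at h1
  rw [inv_le_iff_one_le_mul₀ hN]
  exact h1

theorem basisElt_eq_coeffNorm_mul (hΩ : IsReinhardtDomain Ω) (hω : IsMultiRadialWeight Ω ω)
    (hadm : IsAdmissible Ω ω) (α : holomorphicIndices Ω ω) {z : Fin n → ℂ} (hz : z ∈ Ω) :
    (basisElt hΩ.isOpen α).1 z = (coeffNorm Ω ω α : ℂ) * monomial α z := by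
  rw [basisElt_apply _ _ hz, coeffNorm_eq_inv hΩ hω hadm]

/-- A square summable series of normalised monomials converges in `L²` to its pointwise sum. -/
theorem hasSum_toLp_of_hasSum (hΩ : IsReinhardtDomain Ω) (hω : IsMultiRadialWeight Ω ω)
    (hadm : IsAdmissible Ω ω) {l : holomorphicIndices Ω ω → ℂ}
    (hl : Summable fun α => ‖l α‖ ^ 2) {F : (Fin n → ℂ) → ℂ}
    (hF : ∀ z ∈ Ω, HasSum (fun α => l α * (basisElt hΩ.isOpen α).1 z) (F z)) :
    ∃ h : MemLp F 2 (weightMeasure Ω ω),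
      HasSum (fun α => l α • toL2 (basisElt hΩ.isOpen α)) (h.toLp F) := by
  have hon := orthonormal_basisElt hΩ hω hadm
  have hsum : Summable fun α => l α • toL2 (basisElt hΩ.isOpen α) := by
    have := (hon.orthogonalFamily.summable_iff_norm_sq_summable l).2 hl
    simpa using this
  obtain ⟨G, hG⟩ := hsum
  obtain ⟨ns, hns, hae⟩ := (tendstoInMeasure_of_tendsto_Lp hG).exists_seq_tendsto_ae'
  have hcoe : ∀ k, (∑ α ∈ ns k, l α • toL2 (basisElt hΩ.isOpen α) : Lp ℂ 2 (weightMeasure Ω ω))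
      =ᵐ[weightMeasure Ω ω] fun z => ∑ α ∈ ns k, l α * (basisElt hΩ.isOpen α).1 z := by
    intro k
    have h1 : (∑ α ∈ ns k, l α • toL2 (basisElt hΩ.isOpen α) : Lp ℂ 2 (weightMeasure Ω ω)) =
        toL2 (∑ α ∈ ns k, l α • basisElt hΩ.isOpen α) := by
      simp_rw [map_sum, map_smul]
    rw [h1]
    filter_upwards [coeFn_toL2 (∑ α ∈ ns k, l α • basisElt hΩ.isOpen α)] with z hz
    rw [hz, Submodule.coe_sum, Finset.sum_apply]
    rfl
  have hGF : G =ᵐ[weightMeasure Ω ω] F := by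
    filter_upwards [hae, ae_all_iff.2 hcoe, ae_mem_of_isOpen (ω := ω) hΩ.isOpen] with z h1 h2 hz
    refine tendsto_nhds_unique h1 ?_
    simp_rw [h2]
    exact (hF z hz).comp hns
  have hmem : MemLp F 2 (weightMeasure Ω ω) := (memLp_congr_ae hGF).1 (Lp.memLp G)
  refine ⟨hmem, ?_⟩
  convert hG using 1
  exact Lp.ext (hmem.coeFn_toLp.trans hGF.symm)

/-- The normalised monomials span the Bergman space. -/
theorem hasSum_inner_smul_basisElt (hΩ : IsReinhardtDomain Ω) (hω : IsMultiRadialWeight Ω ω)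
    (hadm : IsAdmissible Ω ω) (f : BergmanSpace Ω ω) :
    HasSum (fun α : holomorphicIndices Ω ω =>
      inner ℂ (toL2 (basisElt hΩ.isOpen α)) (toL2 f) • toL2 (basisElt hΩ.isOpen α)) (toL2 f) := by
  obtain ⟨_, h⟩ := hasSum_toLp_of_hasSum hΩ hω hadm
    ((orthonormal_basisElt hΩ hω hadm).inner_products_summable (toL2 f))
    fun z hz => hasSum_inner_mul_basisElt hΩ hω hadm f hz
  exact h

end Basis

/-! ### Fourier coefficients of smooth periodic functions -/

section Lift

/-- The covering map `ℝⁿ → (ℝ/ℤ)ⁿ`. -/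
def toTorus (x : Fin n → ℝ) : UnitAddTorus (Fin n) := fun j => (x j : UnitAddCircle)

theorem isOpenQuotientMap_toTorus : IsOpenQuotientMap (toTorus (n := n)) :=
  IsOpenQuotientMap.piMap fun _ => QuotientAddGroup.isOpenQuotientMap_mk

theorem toTorus_add (x y : Fin n → ℝ) : toTorus (x + y) = toTorus x + toTorus y := by
  funext j
  simp [toTorus]

theorem toTorus_zero : toTorus (0 : Fin n → ℝ) = 0 := by
  funext j
  simp [toTorus]

/-- Periodicity: a test function factors through the torus. -/
theorem testFunction_eq_of_toTorus_eq (φ : TestFunction n) {x y : Fin n → ℝ}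
    (h : toTorus x = toTorus y) : φ.1 x = φ.1 y := by
  have h1 : ∀ j, ∃ k : ℤ, k • (1 : ℝ) = x j - y j := by
    intro j
    have h2 : ((x j - y j : ℝ) : UnitAddCircle) = 0 := by
      rw [AddCircle.coe_sub, sub_eq_zero]
      exact congrFun h j
    exact AddCircle.coe_eq_zero_iff _ |>.1 h2
  choose k hk using h1
  have hxy : x = y + fun j => (k j : ℝ) := by
    funext j
    have := hk j
    simp only [zsmul_eq_mul, mul_one] at this
    simp [this]
  rw [hxy]
  exact φ.2.2 y k

/-- The function on the torus `(ℝ/ℤ)ⁿ` defined by a periodic function on `ℝⁿ`. -/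
noncomputable def torusLift (φ : TestFunction n) : C(UnitAddTorus (Fin n), ℂ) where
  toFun t := φ.1 (Function.surjInv isOpenQuotientMap_toTorus.surjective t)
  continuous_toFun := by
    refine isOpenQuotientMap_toTorus.isQuotientMap.continuous_iff.2 ?_
    refine φ.2.1.continuous.congr fun x => ?_
    exact testFunction_eq_of_toTorus_eq φ (Function.surjInv_eq _ _).symm

theorem torusLift_toTorus (φ : TestFunction n) (x : Fin n → ℝ) :
    torusLift φ (toTorus x) = φ.1 x :=
  testFunction_eq_of_toTorus_eq φ (Function.surjInv_eq _ _)

theorem torusLift_ext {φ : TestFunction n} {F : C(UnitAddTorus (Fin n), ℂ)}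
    (h : ∀ x, F (toTorus x) = φ.1 x) : torusLift φ = F := by
  ext t
  obtain ⟨x, rfl⟩ := isOpenQuotientMap_toTorus.surjective t
  rw [torusLift_toTorus, h]

theorem mFourier_toTorus (α : Fin n → ℤ) (x : Fin n → ℝ) :
    mFourier α (toTorus x) = character α x := by
  simp only [mFourier, ContinuousMap.coe_mk, toTorus, fourier_coe_apply, character,
    ← Complex.exp_sum, Finset.mul_sum]
  congr 1
  refine Finset.sum_congr rfl fun j _ => ?_
  push_cast
  ring

theorem torusLift_character (α : Fin n → ℤ) :
    torusLift ⟨character α, character_mem α⟩ = mFourier α :=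
  torusLift_ext fun x => mFourier_toTorus α x

theorem torusLift_translate (φ : TestFunction n) (x : Fin n → ℝ) (t : UnitAddTorus (Fin n)) :
    torusLift (translate x φ) t = torusLift φ (t + toTorus x) := by
  obtain ⟨y, rfl⟩ := isOpenQuotientMap_toTorus.surjective t
  rw [torusLift_toTorus, ← toTorus_add, torusLift_toTorus, add_comm]
  rfl

/-- The Fourier coefficient of a smooth periodic function. -/
noncomputable def testCoeff (φ : TestFunction n) (α : Fin n → ℤ) : ℂ :=
  mFourierCoeff (torusLift φ) α

theorem testCoeff_eq (φ : TestFunction n) (α : Fin n → ℤ) :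
    testCoeff φ α = ∫ t, mFourier (-α) t * torusLift φ t ∂torusMeasure n := rfl

theorem integrable_torus (F : C(UnitAddTorus (Fin n), ℂ)) : Integrable F (torusMeasure n) :=
  F.continuous.integrable_of_hasCompactSupport (HasCompactSupport.of_compactSpace _)

theorem testCoeff_add (φ ψ : TestFunction n) (α : Fin n → ℤ) :
    testCoeff (φ + ψ) α = testCoeff φ α + testCoeff ψ α := by
  have h : torusLift (φ + ψ) = torusLift φ + torusLift ψ :=
    torusLift_ext fun x => by simp [torusLift_toTorus]
  simp only [testCoeff_eq, h, ContinuousMap.add_apply, mul_add]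
  exact integral_add (integrable_torus (mFourier (-α) * torusLift φ))
    (integrable_torus (mFourier (-α) * torusLift ψ))

theorem testCoeff_smul (c : ℂ) (φ : TestFunction n) (α : Fin n → ℤ) :
    testCoeff (c • φ) α = c * testCoeff φ α := by
  have h : torusLift (c • φ) = c • torusLift φ :=
    torusLift_ext fun x => by simp [torusLift_toTorus]
  simp only [testCoeff_eq, h, ContinuousMap.smul_apply, smul_eq_mul, mul_left_comm _ c]
  exact integral_const_mul _ _

theorem testCoeff_character (α β : Fin n → ℤ) :
    testCoeff ⟨character β, character_mem β⟩ α = if α = β then 1 else 0 := by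
  rw [testCoeff_eq, torusLift_character, integral_mFourier_mul_mFourier]

theorem mFourier_add_apply (α : Fin n → ℤ) (s t : UnitAddTorus (Fin n)) :
    mFourier α (s + t) = mFourier α s * mFourier α t := by
  rw [← monomial_torusPoint, torusPoint_add, monomial_mul, monomial_torusPoint,
    monomial_torusPoint]

theorem testCoeff_translate (φ : TestFunction n) (x : Fin n → ℝ) (α : Fin n → ℤ) :
    testCoeff (translate x φ) α = character α x * testCoeff φ α := by
  have h := integral_add_right_eq_self (μ := torusMeasure n)
    (fun t => mFourier (-α) t * torusLift φ t) (toTorus x)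
  rw [testCoeff_eq, testCoeff_eq, ← h, ← integral_const_mul]
  refine integral_congr_ae (ae_of_all _ fun t => ?_)
  have h1 : mFourier α (toTorus x) * mFourier (-α) (toTorus x) = 1 := by
    rw [← mFourier_add, add_neg_cancel, mFourier_zero]
    rfl
  dsimp only
  rw [torusLift_translate, mFourier_add_apply, ← mFourier_toTorus]
  linear_combination (-(mFourier (-α) t * torusLift φ (t + toTorus x))) * h1

theorem norm_testCoeff_le (φ : TestFunction n) (α : Fin n → ℤ) :
    ‖testCoeff φ α‖ ≤ ‖torusLift φ‖ := by
  rw [testCoeff_eq]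
  refine (norm_integral_le_of_norm_le_const (C := ‖torusLift φ‖) (ae_of_all _ fun t => ?_)).trans ?_
  · rw [norm_mul, norm_mFourier_apply, one_mul]
    exact (torusLift φ).norm_coe_le_norm t
  · simp

/-- The partial derivative `∂φ/∂x_j`. -/
noncomputable def partialDeriv (j : Fin n) (φ : TestFunction n) : TestFunction n :=
  ⟨fun x => fderiv ℝ φ.1 x (Pi.single j 1), by
    refine ⟨(φ.2.1.fderiv_right (m := ((⊤ : ℕ∞) : WithTop ℕ∞)) (by simp)).clm_apply
      contDiff_const, fun x k => ?_⟩
    have h : (fun y => φ.1 (y + fun j => (k j : ℝ))) = φ.1 := funext fun y => φ.2.2 y k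
    have h2 := fderiv_comp_add_right (𝕜 := ℝ) (f := φ.1) (x := x) (fun j => (k j : ℝ))
    rw [h] at h2
    exact congrArg (fun A => A (Pi.single j 1)) h2.symm⟩

theorem hasDerivAt_torusLift (j : Fin n) (φ : TestFunction n) (t : UnitAddTorus (Fin n)) (s : ℝ) :
    HasDerivAt (fun s : ℝ => torusLift φ (t + toTorus (Pi.single j s)))
      (torusLift (partialDeriv j φ) (t + toTorus (Pi.single j s))) s := by
  obtain ⟨y, rfl⟩ := isOpenQuotientMap_toTorus.surjective t
  simp_rw [← toTorus_add, torusLift_toTorus]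
  have h1 : HasDerivAt (fun s : ℝ => y + Pi.single j s) (Pi.single j (1 : ℝ)) s :=
    (hasDerivAt_single j s).const_add y
  exact ((φ.2.1.differentiable (by simp)).differentiableAt.hasFDerivAt).comp_hasDerivAt s h1

theorem testCoeff_partialDeriv (j : Fin n) (φ : TestFunction n) (α : Fin n → ℤ) :
    testCoeff (partialDeriv j φ) α = 2 * Real.pi * Complex.I * α j * testCoeff φ α := by
  -- Differentiate the Fourier coefficient of the translates of `φ` in direction `j`.
  have h1 := (hasDerivAt_integral_of_dominated_loc_of_deriv_le (μ := torusMeasure n) (𝕜 := ℝ)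
    (F := fun s t => mFourier (-α) t * torusLift φ (t + toTorus (Pi.single j s)))
    (F' := fun s t => mFourier (-α) t * torusLift (partialDeriv j φ) (t + toTorus (Pi.single j s)))
    (x₀ := 0) (s := univ) (bound := fun _ => ‖torusLift (partialDeriv j φ)‖) univ_mem
    (Eventually.of_forall fun s => Continuous.aestronglyMeasurable (by fun_prop))
    (Continuous.integrable_of_hasCompactSupport (by fun_prop) (HasCompactSupport.of_compactSpace _))
    (Continuous.aestronglyMeasurable (by fun_prop))
    (ae_of_all _ fun t s _ => by
      rw [norm_mul, norm_mFourier_apply, one_mul]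
      exact (torusLift (partialDeriv j φ)).norm_coe_le_norm _)
    (integrable_const _)
    (ae_of_all _ fun t s _ => (hasDerivAt_torusLift j φ t s).const_mul _)).2
  have h2 : (fun s : ℝ => ∫ t, mFourier (-α) t * torusLift φ (t + toTorus (Pi.single j s))
      ∂torusMeasure n) = fun s : ℝ =>
        Complex.exp (2 * Real.pi * Complex.I * (α j * s)) * testCoeff φ α := by
    funext s
    simp_rw [← torusLift_translate]
    rw [← testCoeff_eq, testCoeff_translate, character]
    congr 4
    rw [Finset.sum_eq_single j]
    · simp
    · intro i _ hij
      simp [hij]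
    · simp
  rw [h2] at h1
  have h3 : HasDerivAt (fun s : ℝ => Complex.exp (2 * Real.pi * Complex.I * (α j * s))
      * testCoeff φ α) (2 * Real.pi * Complex.I * α j * testCoeff φ α) 0 := by
    have h4 := ((((Complex.ofRealCLM.hasDerivAt (x := (0 : ℝ))).const_mul (α j : ℂ)).const_mul
      (2 * Real.pi * Complex.I : ℂ)).cexp).mul_const (testCoeff φ α)
    simpa [mul_assoc] using h4
  have h5 := h1.unique h3
  rw [← h5, testCoeff_eq]
  simp [toTorus_zero]

theorem testCoeff_iterate_partialDeriv (j : Fin n) (φ : TestFunction n) (α : Fin n → ℤ) (k : ℕ) :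
    testCoeff ((partialDeriv j)^[k] φ) α =
      (2 * Real.pi * Complex.I * α j) ^ k * testCoeff φ α := by
  induction k with
  | zero => simp
  | succ k ih =>
    rw [Function.iterate_succ_apply', testCoeff_partialDeriv, ih, pow_succ]
    ring

theorem norm_iteratedFDeriv_partialDeriv_le (j : Fin n) (φ : TestFunction n) (m : ℕ)
    (x : Fin n → ℝ) :
    ‖iteratedFDeriv ℝ m (partialDeriv j φ).1 x‖ ≤ ‖iteratedFDeriv ℝ (m + 1) φ.1 x‖ := by
  set L : ((Fin n → ℝ) →L[ℝ] ℂ) →L[ℝ] ℂ :=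
    ContinuousLinearMap.apply ℝ ℂ (Pi.single j (1 : ℝ)) with hL
  have hnorm : ‖L‖ ≤ 1 := by
    refine ContinuousLinearMap.opNorm_le_bound _ zero_le_one fun A => ?_
    calc ‖A (Pi.single j 1)‖ ≤ ‖A‖ * ‖(Pi.single j 1 : Fin n → ℝ)‖ := A.le_opNorm _
      _ = 1 * ‖A‖ := by rw [Pi.norm_single, norm_one, mul_comm]
  have h := L.norm_iteratedFDeriv_comp_left (f := fderiv ℝ φ.1) (x := x) (n := m)
    (N := ((⊤ : ℕ∞) : WithTop ℕ∞))
    ((φ.2.1.fderiv_right (m := ((⊤ : ℕ∞) : WithTop ℕ∞)) (by simp)).contDiffAt)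
    (by exact_mod_cast le_top)
  rw [norm_iteratedFDeriv_fderiv] at h
  calc ‖iteratedFDeriv ℝ m (partialDeriv j φ).1 x‖ ≤ _ := h
    _ ≤ 1 * ‖iteratedFDeriv ℝ (m + 1) φ.1 x‖ := by gcongr
    _ = _ := one_mul _

theorem norm_iteratedFDeriv_iterate_partialDeriv_le (j : Fin n) (φ : TestFunction n) (k m : ℕ)
    (x : Fin n → ℝ) :
    ‖iteratedFDeriv ℝ m ((partialDeriv j)^[k] φ).1 x‖ ≤ ‖iteratedFDeriv ℝ (m + k) φ.1 x‖ := by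
  induction k generalizing m with
  | zero => simp
  | succ k ih =>
    rw [Function.iterate_succ_apply']
    refine (norm_iteratedFDeriv_partialDeriv_le j _ m x).trans ((ih (m + 1)).trans ?_)
    rw [show m + 1 + k = m + (k + 1) by ring]

theorem norm_pow_le_sum (α : Fin n → ℤ) {k : ℕ} (hk : k ≠ 0) : ‖α‖ ^ k ≤ ∑ j, ‖α j‖ ^ k := by
  rcases isEmpty_or_nonempty (Fin n) with h | h
  · have : α = 0 := Subsingleton.elim _ _
    simp [this, hk]
  obtain ⟨j, -, hj⟩ := Finset.exists_max_image Finset.univ (fun j => ‖α j‖) Finset.univ_nonempty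
  have h1 : ‖α‖ ≤ ‖α j‖ :=
    (pi_norm_le_iff_of_nonneg (norm_nonneg _)).2 fun i => hj i (Finset.mem_univ i)
  exact (pow_le_pow_left₀ (norm_nonneg _) h1 k).trans
    (Finset.single_le_sum (f := fun j => ‖α j‖ ^ k) (fun i _ => by positivity) (Finset.mem_univ j))

/-- Rapid decay of Fourier coefficients, obtained by differentiating `k` times in the direction of the
largest component of `α`; all directions are summed to avoid choosing one. -/
theorem norm_testCoeff_mul_le (φ : TestFunction n) (α : Fin n → ℤ) {k : ℕ} (hk : k ≠ 0) :
    ‖testCoeff φ α‖ * (1 + ‖α‖ ^ k) ≤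
      ‖torusLift φ‖ + ∑ j, ‖torusLift ((partialDeriv j)^[k] φ)‖ := by
  rw [mul_add, mul_one]
  refine add_le_add (norm_testCoeff_le φ α) ?_
  refine (mul_le_mul_of_nonneg_left (norm_pow_le_sum α hk) (norm_nonneg _)).trans ?_
  rw [Finset.mul_sum]
  refine Finset.sum_le_sum fun j _ => ?_
  refine le_trans ?_ (norm_testCoeff_le ((partialDeriv j)^[k] φ) α)
  rw [testCoeff_iterate_partialDeriv, norm_mul, norm_pow, mul_comm]
  refine mul_le_mul_of_nonneg_right (pow_le_pow_left₀ (norm_nonneg _) ?_ k) (norm_nonneg _)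
  have h1 : ‖(2 * Real.pi * Complex.I * α j : ℂ)‖ = 2 * Real.pi * ‖α j‖ := by
    rw [norm_mul, norm_mul, norm_mul, Complex.norm_I, Complex.norm_real, Complex.norm_intCast,
      Real.norm_of_nonneg Real.pi_pos.le, Int.norm_eq_abs]
    simp
  rw [h1]
  have h2 : 1 ≤ 2 * Real.pi := by linarith [Real.pi_gt_three]
  nlinarith [norm_nonneg (α j)]

theorem exists_norm_testCoeff_le (φ : TestFunction n) (k : ℕ) :
    ∃ C : ℝ, 0 ≤ C ∧ ∀ α, ‖testCoeff φ α‖ ≤ C * (1 + ‖α‖ ^ (k + 1))⁻¹ := by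
  refine ⟨‖torusLift φ‖ + ∑ j, ‖torusLift ((partialDeriv j)^[k + 1] φ)‖, by positivity,
    fun α => ?_⟩
  rw [← div_eq_mul_inv, le_div_iff₀ (by positivity)]
  exact norm_testCoeff_mul_le φ α k.succ_ne_zero

theorem norm_torusLift_le {φ : TestFunction n} {M : ℝ} (h : ∀ x, ‖φ.1 x‖ ≤ M) :
    ‖torusLift φ‖ ≤ M := by
  refine (ContinuousMap.norm_le _ ((norm_nonneg _).trans (h 0))).2 fun t => ?_
  obtain ⟨x, rfl⟩ := isOpenQuotientMap_toTorus.surjective t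
  rw [torusLift_toTorus]
  exact h x

theorem norm_testCoeff_le_of_iteratedFDeriv_le {φ : TestFunction n} {k : ℕ} {M : ℝ}
    (h : ∀ m ≤ k + 1, ∀ x, ‖iteratedFDeriv ℝ m φ.1 x‖ ≤ M) (α : Fin n → ℤ) :
    ‖testCoeff φ α‖ ≤ (n + 1) * M * (1 + ‖α‖ ^ (k + 1))⁻¹ := by
  rw [← div_eq_mul_inv, le_div_iff₀ (by positivity)]
  refine (norm_testCoeff_mul_le φ α k.succ_ne_zero).trans ?_
  have h0 : ‖torusLift φ‖ ≤ M := norm_torusLift_le fun x => by simpa using h 0 (by omega) x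
  have h1 : ∀ j, ‖torusLift ((partialDeriv j)^[k + 1] φ)‖ ≤ M := fun j =>
    norm_torusLift_le fun x => by
      have := norm_iteratedFDeriv_iterate_partialDeriv_le j φ (k + 1) 0 x
      rw [norm_iteratedFDeriv_zero, zero_add] at this
      exact this.trans (h _ le_rfl x)
  calc ‖torusLift φ‖ + ∑ j, ‖torusLift ((partialDeriv j)^[k + 1] φ)‖ ≤ M + ∑ _j : Fin n, M :=
        add_le_add h0 (Finset.sum_le_sum fun j _ => h1 j)
    _ = (n + 1) * M := by
        simp
        ring

theorem summable_inv_one_add_norm_pow (n : ℕ) :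
    Summable fun α : Fin n → ℤ => (1 + ‖α‖ ^ (n + 1))⁻¹ := by
  set L : Submodule ℤ (Fin n → ℝ) := Submodule.span ℤ (Set.range (Pi.basisFun ℝ (Fin n))) with hL
  have hrank : Module.finrank ℤ L = n := by
    rw [ZLattice.rank ℝ L]
    simp
  have hs := ZLattice.summable_norm_pow_inv L (n + 1) (by omega)
  have hmem : ∀ α : Fin n → ℤ, (fun j => (α j : ℝ)) ∈ L := by
    intro α
    have : (fun j => (α j : ℝ)) = ∑ j, α j • Pi.basisFun ℝ (Fin n) j := by
      funext i
      simp [Finset.sum_apply, Pi.single_apply]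
    rw [this]
    exact Submodule.sum_mem _ fun j _ => L.smul_mem _ (Submodule.subset_span ⟨j, rfl⟩)
  have hinj : Function.Injective fun α : Fin n → ℤ => (⟨_, hmem α⟩ : L) := by
    intro α β h
    funext j
    have : (α j : ℝ) = β j := congrFun (Subtype.ext_iff.1 h) j
    exact_mod_cast this
  have hnorm : ∀ α : Fin n → ℤ, ‖(⟨_, hmem α⟩ : L)‖ = ‖α‖ := by
    intro α
    change ‖fun j => (α j : ℝ)‖ = ‖α‖
    refine le_antisymm ?_ ?_
    · refine (pi_norm_le_iff_of_nonneg (norm_nonneg _)).2 fun j => ?_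
      simpa [Int.norm_eq_abs] using norm_le_pi_norm α j
    · refine (pi_norm_le_iff_of_nonneg (norm_nonneg _)).2 fun j => ?_
      simpa [Int.norm_eq_abs] using norm_le_pi_norm (fun j => (α j : ℝ)) j
  have h1 := hs.comp_injective hinj
  have h2 : Summable fun α : Fin n → ℤ => if α = 0 then (1 : ℝ) else 0 :=
    (hasSum_ite_eq 0 1).summable
  refine Summable.of_nonneg_of_le (fun α => by positivity) (fun α => ?_) (h1.add h2)
  simp only [Function.comp, hnorm]
  by_cases h0 : α = 0
  · simp [h0]
  · have : 0 < ‖α‖ := norm_pos_iff.2 h0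
    simp only [h0, if_false, add_zero, inv_pow]
    exact inv_anti₀ (by positivity) (by linarith)

end Lift

/-! ### Periodic distributions with bounded Fourier coefficients -/

section Distribution

theorem norm_iteratedFDeriv_character_le (α : Fin n → ℤ) (k : ℕ) (x : Fin n → ℝ) :
    ‖iteratedFDeriv ℝ k (character α) x‖ ≤ (2 * Real.pi * n * ‖α‖) ^ k := by
  set L : (Fin n → ℝ) →L[ℝ] ℝ :=
    ∑ j, (α j : ℝ) • ContinuousLinearMap.proj (R := ℝ) (φ := fun _ : Fin n => ℝ) j with hL
  set g : ℝ → ℂ := fun s => Complex.exp (2 * Real.pi * Complex.I * s) with hg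
  have hgd : ∀ s, HasDerivAt g (2 * Real.pi * Complex.I * g s) s := by
    intro s
    have := ((Complex.ofRealCLM.hasDerivAt (x := s)).const_mul
      (2 * Real.pi * Complex.I : ℂ)).cexp
    simpa [hg, mul_comm] using this
  have hgk : ∀ k : ℕ, iteratedDeriv k g = fun s => (2 * Real.pi * Complex.I) ^ k * g s := by
    intro k
    induction k with
    | zero => simp
    | succ k ih =>
      rw [iteratedDeriv_succ, ih]
      funext s
      rw [((hgd s).const_mul _).deriv, pow_succ]
      ring
  have hgsmooth : ContDiff ℝ ((⊤ : ℕ∞) : WithTop ℕ∞) g :=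
    Complex.contDiff_exp.comp (contDiff_const.mul Complex.ofRealCLM.contDiff)
  have hcomp : character α = g ∘ L := by
    funext y
    simp [character, hg, hL]
  have hLn : ‖L‖ ≤ n * ‖α‖ := by
    refine ContinuousLinearMap.opNorm_le_bound _ (by positivity) fun y => ?_
    rw [hL, sum_apply]
    calc ‖∑ j, ((α j : ℝ) • ContinuousLinearMap.proj (R := ℝ) (φ := fun _ : Fin n => ℝ) j) y‖
        ≤ ∑ _j : Fin n, ‖α‖ * ‖y‖ := by
          refine norm_sum_le_of_le _ fun j _ => ?_
          rw [smul_apply, norm_smul]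
          refine mul_le_mul ?_ (norm_le_pi_norm y j) (norm_nonneg _) (norm_nonneg _)
          simpa [Int.norm_eq_abs] using norm_le_pi_norm α j
      _ = n * ‖α‖ * ‖y‖ := by
          simp
          ring
  have hgn : ∀ s, ‖g s‖ = 1 := by
    intro s
    rw [hg]
    convert Complex.norm_exp_ofReal_mul_I (2 * Real.pi * s) using 3
    push_cast
    ring
  rw [hcomp, L.iteratedFDeriv_comp_right hgsmooth x (by exact_mod_cast le_top)]
  refine (ContinuousMultilinearMap.norm_compContinuousLinearMap_le _ _).trans ?_
  rw [norm_iteratedFDeriv_eq_norm_iteratedDeriv, hgk, norm_mul, hgn, Finset.prod_const,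
    Finset.card_univ, Fintype.card_fin, mul_one, norm_pow, ← mul_pow]
  refine pow_le_pow_left₀ (by positivity) ?_ k
  have h1 : ‖(2 * Real.pi * Complex.I : ℂ)‖ = 2 * Real.pi := by
    simp [abs_of_pos Real.pi_pos]
  rw [h1, mul_assoc (2 * Real.pi)]
  exact mul_le_mul_of_nonneg_left hLn (by positivity)

theorem norm_character (α : Fin n → ℤ) (x : Fin n → ℝ) : ‖character α x‖ = 1 := by
  rw [← mFourier_toTorus, norm_mFourier_apply]

theorem summable_testCoeff_mul (φ : TestFunction n) {a : (Fin n → ℤ) → ℂ} {C : ℝ}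
    (ha : ∀ α, ‖a α‖ ≤ C) : Summable fun α => a α * testCoeff φ (-α) := by
  obtain ⟨D, hD, h⟩ := exists_norm_testCoeff_le φ n
  refine Summable.of_norm_bounded ((summable_inv_one_add_norm_pow n).mul_left (C * D))
    fun α => ?_
  have h1 := h (-α)
  rw [norm_neg] at h1
  rw [norm_mul, mul_assoc]
  exact mul_le_mul (ha α) h1 (norm_nonneg _) ((norm_nonneg _).trans (ha α))

/-- The periodic distribution with given bounded Fourier coefficients `a`. -/
noncomputable def ofCoeff (a : (Fin n → ℤ) → ℂ) (ha : ∃ C : ℝ, ∀ α, ‖a α‖ ≤ C) :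
    PeriodicDistribution n where
  toLinearMap :=
    { toFun := fun φ => ∑' α, a α * testCoeff φ (-α)
      map_add' := fun φ ψ => by
        obtain ⟨C, hC⟩ := ha
        simp_rw [testCoeff_add, mul_add]
        exact (summable_testCoeff_mul φ hC).tsum_add (summable_testCoeff_mul ψ hC)
      map_smul' := fun c φ => by
        simp_rw [testCoeff_smul, mul_left_comm _ c]
        exact tsum_mul_left }
  continuous := by
    obtain ⟨C, hC⟩ := ha
    refine ⟨n + 1, C * (n + 1) * ∑' α : Fin n → ℤ, (1 + ‖α‖ ^ (n + 1))⁻¹, fun φ M hM => ?_⟩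
    have hs := summable_inv_one_add_norm_pow n
    have hb : ∀ α : Fin n → ℤ, ‖a α * testCoeff φ (-α)‖ ≤
        C * ((n + 1) * M) * (1 + ‖α‖ ^ (n + 1))⁻¹ := by
      intro α
      have h1 := norm_testCoeff_le_of_iteratedFDeriv_le hM (-α)
      rw [norm_neg] at h1
      rw [norm_mul, mul_assoc]
      exact mul_le_mul (hC α) h1 (norm_nonneg _) ((norm_nonneg _).trans (hC α))
    refine (tsum_of_norm_bounded (hs.mul_left _).hasSum hb).trans (le_of_eq ?_)
    rw [tsum_mul_left]
    ring

theorem ofCoeff_apply (a : (Fin n → ℤ) → ℂ) (ha : ∃ C : ℝ, ∀ α, ‖a α‖ ≤ C)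
    (φ : TestFunction n) :
    (ofCoeff a ha).toLinearMap φ = ∑' α, a α * testCoeff φ (-α) := rfl

theorem fourierCoeff_ofCoeff (a : (Fin n → ℤ) → ℂ) (ha : ∃ C : ℝ, ∀ α, ‖a α‖ ≤ C)
    (α : Fin n → ℤ) : (ofCoeff a ha).fourierCoeff α = a α := by
  rw [PeriodicDistribution.fourierCoeff, ofCoeff_apply, tsum_eq_single α]
  · simp [testCoeff_character]
  · intro β hβ
    simp [testCoeff_character, hβ]

/-- Multiplying the Fourier coefficients of a test function by a bounded sequence gives the Fourier
series of a test function. -/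
theorem exists_testFunction_of_bounded (φ : TestFunction n) {b : (Fin n → ℤ) → ℂ} {C : ℝ}
    (hb : ∀ α, ‖b α‖ ≤ C) : ∃ ψ : TestFunction n,
      ∀ x, HasSum (fun α => b α * testCoeff φ α * character α x) (ψ.1 x) := by
  have hC : 0 ≤ C := (norm_nonneg _).trans (hb 0)
  have hsum := summable_inv_one_add_norm_pow n
  -- The Fourier coefficients of `φ` decay faster than any power, so all derivatives converge.
  have hkey : ∀ k : ℕ, ∃ v : (Fin n → ℤ) → ℝ, Summable v ∧ ∀ α,
      ‖b α * testCoeff φ α‖ * (2 * Real.pi * n * ‖α‖) ^ k ≤ v α := by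
    intro k
    obtain ⟨D, hD, h⟩ := exists_norm_testCoeff_le φ (n + k)
    refine ⟨fun α => C * D * (2 * Real.pi * n) ^ k * 2 * (1 + ‖α‖ ^ (n + 1))⁻¹,
      hsum.mul_left _, fun α => ?_⟩
    have h1 : (1 + ‖α‖ ^ (n + k + 1))⁻¹ * ‖α‖ ^ k ≤ 2 * (1 + ‖α‖ ^ (n + 1))⁻¹ := by
      rw [inv_mul_eq_div, ← div_eq_mul_inv, div_le_div_iff₀ (by positivity) (by positivity)]
      have h2 : ‖α‖ ^ k ≤ 1 + ‖α‖ ^ (n + k + 1) := by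
        rcases le_total ‖α‖ 1 with h3 | h3
        · have := pow_le_one₀ (n := k) (norm_nonneg α) h3
          have : 0 ≤ ‖α‖ ^ (n + k + 1) := by positivity
          linarith
        · have := pow_le_pow_right₀ h3 (show k ≤ n + k + 1 by omega)
          linarith
      have h4 : ‖α‖ ^ k * ‖α‖ ^ (n + 1) = ‖α‖ ^ (n + k + 1) := by ring
      rw [mul_add, mul_one, h4]
      linarith
    calc ‖b α * testCoeff φ α‖ * (2 * Real.pi * n * ‖α‖) ^ k
        ≤ (C * (D * (1 + ‖α‖ ^ (n + k + 1))⁻¹)) * (2 * Real.pi * n * ‖α‖) ^ k := by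
          rw [norm_mul]
          exact mul_le_mul_of_nonneg_right (mul_le_mul (hb α) (h α) (norm_nonneg _) hC)
            (by positivity)
      _ = (C * D * (2 * Real.pi * n) ^ k) * ((1 + ‖α‖ ^ (n + k + 1))⁻¹ * ‖α‖ ^ k) := by
          rw [mul_pow (2 * Real.pi * n)]
          ring
      _ ≤ (C * D * (2 * Real.pi * n) ^ k) * (2 * (1 + ‖α‖ ^ (n + 1))⁻¹) :=
          mul_le_mul_of_nonneg_left h1 (by positivity)
      _ = _ := by ring
  choose v hv hv' using hkey
  have hcd : ContDiff ℝ ((⊤ : ℕ∞) : WithTop ℕ∞)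
      (fun x => ∑' α, b α * testCoeff φ α * character α x) := by
    refine contDiff_tsum (v := v) (fun α => ?_) (fun k _ => hv k) fun k α x _ => ?_
    · exact contDiff_const.mul (character_mem α).1
    · have h1 : (fun x => b α * testCoeff φ α * character α x) =
          (b α * testCoeff φ α) • character α := rfl
      rw [h1, iteratedFDeriv_const_smul_apply
        ((character_mem α).1.of_le (by exact_mod_cast le_top)).contDiffAt, norm_smul]
      exact (mul_le_mul_of_nonneg_left (norm_iteratedFDeriv_character_le α k x)
        (norm_nonneg _)).trans (hv' k α)
  have hs : ∀ x, Summable fun α => b α * testCoeff φ α * character α x := by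
    intro x
    refine Summable.of_norm_bounded (hv 0) fun α => ?_
    have := hv' 0 α
    rw [pow_zero, mul_one] at this
    rwa [norm_mul, norm_character, mul_one]
  refine ⟨⟨_, hcd, fun x k => ?_⟩, fun x => (hs x).hasSum⟩
  refine tsum_congr fun α => ?_
  rw [(character_mem α).2 x k]

/-- Convolution multiplies Fourier coefficients. -/
theorem isConvolution_ofCoeff {a b : (Fin n → ℤ) → ℂ} (ha : ∃ C : ℝ, ∀ α, ‖a α‖ ≤ C)
    (hb : ∃ C : ℝ, ∀ α, ‖b α‖ ≤ C) (hab : ∃ C : ℝ, ∀ α, ‖a α * b α‖ ≤ C) :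
    IsConvolution (ofCoeff a ha) (ofCoeff b hb) (ofCoeff (fun α => a α * b α) hab) := by
  intro φ
  obtain ⟨C, hC⟩ := hb
  obtain ⟨ψ, hψ⟩ := exists_testFunction_of_bounded φ (b := fun α => b (-α)) fun α => hC (-α)
  refine ⟨ψ, fun x => ?_, ?_⟩
  · rw [ofCoeff_apply, ← (hψ x).tsum_eq, ← (Equiv.neg (Fin n → ℤ)).tsum_eq]
    refine tsum_congr fun α => ?_
    rw [Equiv.neg_apply, testCoeff_translate, neg_neg]
    ring
  · have hcoef : ∀ α, testCoeff ψ α = b (-α) * testCoeff φ α := by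
      intro α
      refine mFourierCoeff_of_hasSum (a := fun α => b (-α) * testCoeff φ α) ?_ (fun t => ?_) α
      · have := (hψ 0).summable.norm
        simpa [norm_character] using this
      · obtain ⟨x, rfl⟩ := isOpenQuotientMap_toTorus.surjective t
        rw [torusLift_toTorus]
        simpa only [mFourier_toTorus] using hψ x
    rw [ofCoeff_apply, ofCoeff_apply]
    refine tsum_congr fun α => ?_
    rw [hcoef, neg_neg]
    ring

end Distribution

/-! ### Diagonal operators and their integral kernels -/

section Kernel

variable {Ω : Set (Fin n → ℂ)} {ω : (Fin n → ℂ) → ℝ≥0∞}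

theorem bergman_ext {f g : BergmanSpace Ω ω} (h : ∀ z ∈ Ω, f.1 z = g.1 z) : f = g := by
  refine Subtype.ext (funext fun z => ?_)
  by_cases hz : z ∈ Ω
  · exact h z hz
  · rw [f.2.2.1 z hz, g.2.2.1 z hz]

theorem hasSum_allowable_iff {F : (Fin n → ℤ) → ℂ} (hF : ∀ α ∉ holomorphicIndices Ω ω, F α = 0)
    {s : ℂ} : HasSum (fun α : allowable Ω ω => F α) s ↔
      HasSum (fun α : holomorphicIndices Ω ω => F α) s := by
  have h1 : HasSum (F ∘ ((↑) : allowable Ω ω → Fin n → ℤ)) s ↔ HasSum F s :=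
    Subtype.val_injective.hasSum_iff fun α hα => hF α fun h => hα ⟨⟨α, h.1⟩, rfl⟩
  have h2 : HasSum (F ∘ ((↑) : holomorphicIndices Ω ω → Fin n → ℤ)) s ↔ HasSum F s :=
    Subtype.val_injective.hasSum_iff fun α hα => hF α fun h => hα ⟨⟨α, h⟩, rfl⟩
  exact h1.trans h2.symm

theorem coeffNorm_sq_mul_monomial (hΩ : IsReinhardtDomain Ω) (hω : IsMultiRadialWeight Ω ω)
    (hadm : IsAdmissible Ω ω) (α : holomorphicIndices Ω ω) {z w : Fin n → ℂ} (hz : z ∈ Ω)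
    (hw : w ∈ Ω) : ((coeffNorm Ω ω α ^ 2 : ℝ) : ℂ) * monomial α (z * star w) =
      (basisElt hΩ.isOpen α).1 z * star ((basisElt hΩ.isOpen α).1 w) := by
  rw [basisElt_eq_coeffNorm_mul hΩ hω hadm α hz, basisElt_eq_coeffNorm_mul hΩ hω hadm α hw,
    monomial_mul, monomial_star]
  simp only [star_mul', Complex.star_def, Complex.conj_ofReal]
  push_cast
  ring

/-- The series of the Bergman kernel converges absolutely on `Ω` and on the products `z w̄`. -/
theorem summable_kernel (hΩ : IsReinhardtDomain Ω) (hω : IsMultiRadialWeight Ω ω)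
    (hadm : IsAdmissible Ω ω) (hfeas : IsFeasible Ω ω) {ζ : Fin n → ℂ}
    (hζ : ζ ∈ Ω ∪ conjProduct Ω) : Summable fun α : allowable Ω ω =>
      ‖((coeffNorm Ω ω α ^ 2 : ℝ) : ℂ) * monomial (α : Fin n → ℤ) ζ‖ := by
  rcases hζ with hζ | ⟨z, hz, w, hw, rfl⟩
  · obtain ⟨g, -, hg⟩ := hfeas
    exact (hg ζ hζ).summable.norm
  · have h1 : Summable fun α : holomorphicIndices Ω ω =>
        ((coeffNorm Ω ω α ^ 2 : ℝ) : ℂ) * monomial (α : Fin n → ℤ) (z * star w) := by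
      simp_rw [coeffNorm_sq_mul_monomial hΩ hω hadm _ hz hw]
      refine (summable_mul_of_summable_sq (summable_sq_basisElt hΩ hω hadm hz) ?_).of_norm
      simpa using summable_sq_basisElt hΩ hω hadm hw
    have h2 := (hasSum_allowable_iff (F := fun α =>
      ((coeffNorm Ω ω α ^ 2 : ℝ) : ℂ) * monomial α (z * star w)) fun α hα => by
        simp [coeffNorm_eq_zero hΩ hω hadm hα]).2 h1.hasSum
    exact h2.summable.norm

/-- Integration against the kernel `g(z w̄)`, `g(ζ) = ∑ ‖c_α‖² l_α ζ ^ α`, multiplies the coefficient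
of the `α`-th normalised monomial by `l_α`. -/
theorem hasSum_integral_kernel (hΩ : IsReinhardtDomain Ω) (hω : IsMultiRadialWeight Ω ω)
    (hadm : IsAdmissible Ω ω) {l : (Fin n → ℤ) → ℂ} {C : ℝ}
    (hl : ∀ α ∈ allowable Ω ω, ‖l α‖ ≤ C) {g : (Fin n → ℂ) → ℂ}
    (hg : ∀ ζ ∈ conjProduct Ω, HasSum (fun α : allowable Ω ω =>
      ((coeffNorm Ω ω α ^ 2 : ℝ) : ℂ) * l α * monomial (α : Fin n → ℤ) ζ) (g ζ))
    (f : BergmanSpace Ω ω) {z : Fin n → ℂ} (hz : z ∈ Ω) :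
    Integrable (fun w => f.1 w * g (z * star w)) (weightMeasure Ω ω) ∧
      HasSum (fun α : holomorphicIndices Ω ω =>
        l α * inner ℂ (toL2 (basisElt hΩ.isOpen α)) (toL2 f) * (basisElt hΩ.isOpen α).1 z)
        (∫ w, f.1 w * g (z * star w) ∂weightMeasure Ω ω) := by
  have hker : ∀ w ∈ Ω, HasSum (fun α : holomorphicIndices Ω ω =>
      star (l α * (basisElt hΩ.isOpen α).1 z) * (basisElt hΩ.isOpen α).1 w)
      (star (g (z * star w))) := by
    intro w hw
    have h1 := (hasSum_allowable_iff (F := fun α =>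
      ((coeffNorm Ω ω α ^ 2 : ℝ) : ℂ) * l α * monomial α (z * star w)) fun α hα => by
        simp [coeffNorm_eq_zero hΩ hω hadm hα]).1 (hg _ ⟨z, hz, w, hw, rfl⟩)
    refine h1.star.congr_fun fun α => ?_
    rw [mul_right_comm, coeffNorm_sq_mul_monomial hΩ hω hadm α hz hw]
    simp only [star_mul', star_star]
    ring
  have hsq : Summable fun α : holomorphicIndices Ω ω =>
      ‖star (l α * (basisElt hΩ.isOpen α).1 z)‖ ^ 2 := by
    refine Summable.of_nonneg_of_le (fun α => by positivity) (fun α => ?_)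
      ((summable_sq_basisElt hΩ hω hadm hz).mul_left (C ^ 2))
    rw [norm_star, norm_mul, mul_pow]
    exact mul_le_mul_of_nonneg_right (pow_le_pow_left₀ (norm_nonneg _) (hl α α.2.1) 2)
      (by positivity)
  obtain ⟨hmem, hsum⟩ := hasSum_toLp_of_hasSum hΩ hω hadm hsq hker
  have hval : inner ℂ (hmem.toLp _) (toL2 f) =
      ∫ w, f.1 w * g (z * star w) ∂weightMeasure Ω ω := by
    rw [inner_toLp_toL2]
    simp_rw [star_star, mul_comm]
  refine ⟨?_, ?_⟩
  · have h1 : Integrable (fun w => f.1 w * star (star (g (z * star w)))) (weightMeasure Ω ω) :=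
      MemLp.integrable_mul (p := 2) (q := 2) f.2.2.2 (MemLp.star hmem)
    simpa only [star_star] using h1
  · have h1 := (hsum.mapL (innerSL ℂ (toL2 f))).star
    simp only [innerSL_apply_apply, inner_smul_right] at h1
    rw [← hval, ← inner_conj_symm]
    refine h1.congr_fun fun α => ?_
    rw [star_mul', star_star, ← inner_conj_symm]
    simp only [Complex.star_def]
    ring

theorem differentiableOn_kernel (hΩ : IsReinhardtDomain Ω) (hω : IsMultiRadialWeight Ω ω)
    (hadm : IsAdmissible Ω ω) (hfeas : IsFeasible Ω ω) {l : (Fin n → ℤ) → ℂ} {C : ℝ}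
    (hl : ∀ α, ‖l α‖ ≤ C) :
    (∀ ζ ∈ Ω ∪ conjProduct Ω, Summable fun α : allowable Ω ω =>
      ‖((coeffNorm Ω ω α ^ 2 : ℝ) : ℂ) * l α * monomial (α : Fin n → ℤ) ζ‖) ∧
    DifferentiableOn ℂ (fun ζ => ∑' α : allowable Ω ω,
      ((coeffNorm Ω ω α ^ 2 : ℝ) : ℂ) * l α * monomial (α : Fin n → ℤ) ζ)
      (Ω ∪ conjProduct Ω) := by
  have hs : ∀ ζ ∈ Ω ∪ conjProduct Ω, Summable fun α : allowable Ω ω =>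
      ‖((coeffNorm Ω ω α ^ 2 : ℝ) : ℂ) * l α * monomial (α : Fin n → ℤ) ζ‖ := by
    intro ζ hζ
    refine Summable.of_nonneg_of_le (fun α => norm_nonneg _) (fun α => ?_)
      ((summable_kernel hΩ hω hadm hfeas hζ).mul_left C)
    rw [mul_right_comm, norm_mul, mul_comm]
    exact mul_le_mul_of_nonneg_right (hl α) (norm_nonneg _)
  refine ⟨hs, differentiableOn_tsum_monomial (hΩ.isOpen.union (isOpen_conjProduct hΩ.isOpen))
    hs fun α hα => ?_⟩
  have hmem : (α : Fin n → ℤ) ∈ holomorphicIndices Ω ω := by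
    by_contra h
    simp [coeffNorm_eq_zero hΩ hω hadm h] at hα
  rintro ζ (hζ | hζ)
  · exact hmem.2 ζ hζ
  · exact hmem.2.conjProduct ζ hζ

theorem isInducedBy_ofCoeff (hΩ : IsReinhardtDomain Ω) (hω : IsMultiRadialWeight Ω ω)
    (hadm : IsAdmissible Ω ω) (hfeas : IsFeasible Ω ω) {l : (Fin n → ℤ) → ℂ}
    (hl : ∃ C : ℝ, ∀ α, ‖l α‖ ≤ C) {g : (Fin n → ℂ) → ℂ}
    (hg : ∀ ζ ∈ Ω, HasSum (fun α : allowable Ω ω =>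
      ((coeffNorm Ω ω α ^ 2 : ℝ) : ℂ) * l α * monomial (α : Fin n → ℤ) ζ) (g ζ)) :
    IsInducedBy Ω ω g (ofCoeff l hl) := by
  rintro r ⟨z, hz, hr⟩
  have hrΩ : (fun j => (r j : ℂ)) ∈ Ω := by
    simpa only [hr] using hΩ.norm_mem hz
  obtain ⟨a, ha⟩ : ∃ a : (Fin n → ℤ) → ℂ, a = (allowable Ω ω).indicator
    (fun β => ((coeffNorm Ω ω β ^ 2 : ℝ) : ℂ) * monomial β (fun j => (r j : ℂ))) := ⟨_, rfl⟩
  have hs : Summable fun α => ‖a α‖ := by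
    have h1 := (summable_kernel hΩ hω hadm hfeas (Or.inl hrΩ)).of_norm
    rw [ha]
    exact (summable_subtype_iff_indicator (f := fun β : Fin n → ℤ =>
      ((coeffNorm Ω ω β ^ 2 : ℝ) : ℂ) * monomial β (fun j => (r j : ℂ)))).1 h1 |>.norm
  have hbound : ∃ C : ℝ, ∀ α, ‖a α‖ ≤ C :=
    ⟨∑' α, ‖a α‖, fun α => hs.le_tsum α fun β _ => norm_nonneg (a β)⟩
  have hbound' : ∃ C : ℝ, ∀ α, ‖a α * l α‖ ≤ C := by
    obtain ⟨C, hC⟩ := hl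
    obtain ⟨D, hD⟩ := hbound
    refine ⟨D * C, fun α => ?_⟩
    rw [norm_mul]
    exact mul_le_mul (hD α) (hC α) (norm_nonneg _) ((norm_nonneg _).trans (hD α))
  refine ⟨ofCoeff a hbound, ofCoeff _ hbound', fun α => by rw [fourierCoeff_ofCoeff, ha],
    isConvolution_ofCoeff hbound hl hbound', fun θ => ?_⟩
  have hpt : (fun j => (r j : ℂ) * Complex.exp (2 * Real.pi * Complex.I * (θ j : ℂ))) =
      torusPoint (toTorus θ) * fun j => (r j : ℂ) := by
    funext j
    rw [mul_comm]
    exact congrArg (· * (r j : ℂ)) (congrFun (torusPoint_coe θ) j).symm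
  rw [hpt]
  have h1 := hg _ (hΩ.torus_mul_mem (toTorus θ) hrΩ)
  have h2 := (hasSum_subtype_iff_indicator (s := allowable Ω ω) (f := fun α =>
    ((coeffNorm Ω ω α ^ 2 : ℝ) : ℂ) * l α *
      monomial α (torusPoint (toTorus θ) * fun j => (r j : ℂ)))).1 h1
  refine h2.congr_fun fun α => ?_
  rw [fourierCoeff_ofCoeff, ha]
  by_cases hα : α ∈ allowable Ω ω
  · rw [indicator_of_mem hα, indicator_of_mem hα, monomial_mul, monomial_torusPoint,
      mFourier_toTorus]
    ring
  · rw [indicator_of_notMem hα, indicator_of_notMem hα]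
    ring

/-- A bounded operator that is diagonal in the monomials acts coefficientwise on Laurent series. -/
theorem hasSum_of_diagonal (hΩ : IsReinhardtDomain Ω) (hω : IsMultiRadialWeight Ω ω)
    (hadm : IsAdmissible Ω ω) {R : BergmanSpace Ω ω → BergmanSpace Ω ω}
    (hR : IsBoundedOperator R) {l : (Fin n → ℤ) → ℂ}
    (hl : ∀ α : holomorphicIndices Ω ω, R (basisElt hΩ.isOpen α) = l α • basisElt hΩ.isOpen α)
    (f : BergmanSpace Ω ω) {z : Fin n → ℂ} (hz : z ∈ Ω) :
    HasSum (fun α : holomorphicIndices Ω ω =>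
      l α * inner ℂ (toL2 (basisElt hΩ.isOpen α)) (toL2 f) * (basisElt hΩ.isOpen α).1 z)
      ((R f).1 z) := by
  obtain ⟨C, hC⟩ := hR.bounded
  obtain ⟨D, hD, hDz⟩ := hadm {z} isCompact_singleton (by simpa using hz)
  set A : BergmanSpace Ω ω →ₗ[ℂ] BergmanSpace Ω ω := hR.isLinear.mk' R with hA
  have hsum := hasSum_inner_smul_basisElt hΩ hω hadm f
  rw [HasSum, tendsto_iff_norm_sub_tendsto_zero] at hsum ⊢
  refine squeeze_zero (fun s => norm_nonneg _) (fun s => ?_)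
    (by simpa using hsum.const_mul (D * C))
  set p : BergmanSpace Ω ω := ∑ α ∈ s,
    inner ℂ (toL2 (basisElt hΩ.isOpen α)) (toL2 f) • basisElt hΩ.isOpen α with hp
  have hAp : (A p).1 z = ∑ α ∈ s, l α * inner ℂ (toL2 (basisElt hΩ.isOpen α)) (toL2 f) *
      (basisElt hΩ.isOpen α).1 z := by
    have h1 : A p = ∑ α ∈ s, (l α * inner ℂ (toL2 (basisElt hΩ.isOpen α)) (toL2 f)) •
        basisElt hΩ.isOpen α := by
      rw [hp, map_sum]
      refine Finset.sum_congr rfl fun α _ => ?_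
      rw [map_smul, show A (basisElt hΩ.isOpen α) = _ from hl α, smul_smul, mul_comm]
    rw [h1]
    push_cast
    rw [Finset.sum_apply]
    rfl
  have h2 : (A (p - f)).1 z = (A p).1 z - (R f).1 z := by
    rw [map_sub]
    rfl
  have h3 : toL2 (p - f) = ∑ α ∈ s, inner ℂ (toL2 (basisElt hΩ.isOpen α)) (toL2 f) •
      toL2 (basisElt hΩ.isOpen α) - toL2 f := by
    rw [map_sub, hp, map_sum]
    simp_rw [map_smul]
  rw [← hAp, ← h2, ← h3, norm_toL2]
  calc ‖(A (p - f)).1 z‖ ≤ D * bergmanNorm (A (p - f)) := hDz _ z rfl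
    _ ≤ D * (C * bergmanNorm (p - f)) := mul_le_mul_of_nonneg_left (hC _) hD.le
    _ = _ := by ring

/-- The normalised monomials are eigenvectors of every bounded radial operator. -/
theorem exists_eigenvalues (hΩ : IsReinhardtDomain Ω) (hω : IsMultiRadialWeight Ω ω)
    (hadm : IsAdmissible Ω ω) {R : BergmanSpace Ω ω → BergmanSpace Ω ω}
    (hR : IsBoundedOperator R) (hrad : IsRadial R) :
    ∃ l : (Fin n → ℤ) → ℂ, (∃ C : ℝ, ∀ α, ‖l α‖ ≤ C) ∧
      ∀ α : holomorphicIndices Ω ω, R (basisElt hΩ.isOpen α) = l α • basisElt hΩ.isOpen α := by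
  classical
  have hex : ∀ α : holomorphicIndices Ω ω, ∃ c : ℂ,
      R (basisElt hΩ.isOpen α) = c • basisElt hΩ.isOpen α := by
    intro α
    set b := basisElt hΩ.isOpen α with hb
    have hN : (‖toL2 (bergmanMonomial hΩ.isOpen α)‖ : ℂ) ≠ 0 := by
      exact_mod_cast (norm_bergmanMonomial_pos hΩ hadm α).ne'
    obtain ⟨c, hc, -⟩ := exists_eq_const_mul_monomial hΩ (R b).2.1 (α := α) fun t ht z hz => by
      obtain ⟨V, hV, hVf, hRV⟩ := hrad t ht
      have h1 : V b = monomial α t • b := by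
        refine bergman_ext fun w hw => ?_
        rw [hVf b w hw, hb, basisElt_apply _ _ (hΩ.rotate_mem t ht w hw), monomial_mul]
        change _ = monomial (α : Fin n → ℤ) t * (basisElt hΩ.isOpen α).1 w
        rw [basisElt_apply _ _ hw]
        ring
      rw [← hVf (R b) z hz, ← hRV b, h1, hR.isLinear.map_smul]
      rfl
    refine ⟨c * ‖toL2 (bergmanMonomial hΩ.isOpen α)‖, bergman_ext fun z hz => ?_⟩
    rw [hc z hz]
    change _ = c * ‖toL2 (bergmanMonomial hΩ.isOpen α)‖ * b.1 z
    rw [hb, basisElt_apply _ _ hz]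
    push_cast
    field_simp
  choose c hc using hex
  obtain ⟨C, hC⟩ := hR.bounded
  refine ⟨fun α => if h : α ∈ holomorphicIndices Ω ω then c ⟨α, h⟩ else 0, ⟨max C 0, fun α => ?_⟩,
    fun α => ?_⟩
  · by_cases h : α ∈ holomorphicIndices Ω ω
    · simp only [h, dif_pos]
      refine le_trans ?_ (le_max_left _ _)
      have h1 := hC (basisElt hΩ.isOpen ⟨α, h⟩)
      rw [hc, ← norm_toL2, ← norm_toL2, map_smul, norm_smul,
        (orthonormal_basisElt hΩ hω hadm).1 ⟨α, h⟩, mul_one, mul_one] at h1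
      exact h1
    · simp [h]
  · rw [hc α]
    simp

/-- A map that multiplies coefficients by numbers of modulus at most `C` has norm at most `C`. -/
theorem norm_le_of_hasSum (hΩ : IsReinhardtDomain Ω) (hω : IsMultiRadialWeight Ω ω)
    (hadm : IsAdmissible Ω ω) {l : (Fin n → ℤ) → ℂ} {C : ℝ} (hC0 : 0 ≤ C)
    (hl : ∀ α : holomorphicIndices Ω ω, ‖l α‖ ≤ C) {f h : BergmanSpace Ω ω}
    (hfh : ∀ z ∈ Ω, HasSum (fun α : holomorphicIndices Ω ω =>
      l α * inner ℂ (toL2 (basisElt hΩ.isOpen α)) (toL2 f) * (basisElt hΩ.isOpen α).1 z)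
      (h.1 z)) : bergmanNorm h ≤ C * bergmanNorm f := by
  have hon := orthonormal_basisElt hΩ hω hadm
  have hle : ∀ α : holomorphicIndices Ω ω,
      ‖l α * inner ℂ (toL2 (basisElt hΩ.isOpen α)) (toL2 f)‖ ^ 2 ≤
        C ^ 2 * ‖inner ℂ (toL2 (basisElt hΩ.isOpen α)) (toL2 f)‖ ^ 2 := by
    intro α
    rw [norm_mul, mul_pow]
    exact mul_le_mul_of_nonneg_right (pow_le_pow_left₀ (norm_nonneg _) (hl α) 2) (by positivity)
  have hsq := Summable.of_nonneg_of_le (fun α => by positivity) hle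
    ((hon.inner_products_summable (toL2 f)).mul_left (C ^ 2))
  obtain ⟨hmem, hsum⟩ := hasSum_toLp_of_hasSum hΩ hω hadm hsq hfh
  rw [← norm_toL2, ← norm_toL2]
  refine le_of_tendsto hsum.norm (Eventually.of_forall fun s => ?_)
  refine le_of_sq_le_sq ?_ (by positivity)
  have h1 := hon.orthogonalFamily.norm_sum
    (fun α => l α * inner ℂ (toL2 (basisElt hΩ.isOpen α)) (toL2 f)) s
  simp only [LinearIsometry.toSpanSingleton_apply] at h1
  rw [h1, mul_pow]
  refine (Finset.sum_le_sum fun α _ => hle α).trans ?_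
  rw [← Finset.mul_sum]
  exact mul_le_mul_of_nonneg_left (hon.sum_inner_products_le (toL2 f)) (by positivity)

theorem exists_rotation_operator (hΩ : IsReinhardtDomain Ω) (hω : IsMultiRadialWeight Ω ω)
    {t : Fin n → ℂ} (ht : ∀ j, ‖t j‖ = 1) : ∃ V : BergmanSpace Ω ω → BergmanSpace Ω ω,
      IsBoundedOperator V ∧ ∀ f, ∀ z, (V f).1 z = f.1 (t * z) := by
  have hmp := measurePreserving_mul hΩ hω ht
  refine ⟨fun f => ⟨fun z => f.1 (t * z),
    f.2.1.comp (by fun_prop) fun z hz => hΩ.rotate_mem t ht z hz,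
    fun z hz => f.2.2.1 _ fun h => hz ((mul_mem_iff hΩ ht).1 h),
    f.2.2.2.comp_measurePreserving hmp⟩, ⟨⟨fun _ _ => rfl, fun _ _ => rfl⟩, 1, fun f => ?_⟩,
    fun _ _ => rfl⟩
  rw [one_mul]
  refine le_of_eq (congrArg ENNReal.toReal ?_)
  exact eLpNorm_comp_measurePreserving f.2.2.2.1 hmp

theorem isRadial_of_integral_kernel (hΩ : IsReinhardtDomain Ω) (hω : IsMultiRadialWeight Ω ω)
    {R : BergmanSpace Ω ω → BergmanSpace Ω ω} {g : (Fin n → ℂ) → ℂ}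
    (h : ∀ f : BergmanSpace Ω ω, ∀ z ∈ Ω,
      Integrable (fun w => f.1 w * g (z * star w)) (weightMeasure Ω ω) ∧
      (R f).1 z = ∫ w, f.1 w * g (z * star w) ∂weightMeasure Ω ω) : IsRadial R := by
  intro t ht
  obtain ⟨V, hV, hVf⟩ := exists_rotation_operator hΩ hω ht
  refine ⟨V, hV, fun f z _ => hVf f z, fun f => bergman_ext fun z hz => ?_⟩
  have hmp := measurePreserving_mul hΩ hω ht
  have htz := hΩ.rotate_mem t ht z hz
  rw [hVf, (h _ z hz).2, (h f _ htz).2]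
  conv_rhs => rw [← hmp.map_eq]
  rw [integral_map hmp.measurable.aemeasurable
    (by rw [hmp.map_eq]; exact (h f _ htz).1.aestronglyMeasurable)]
  refine integral_congr_ae (ae_of_all _ fun w => ?_)
  have htt : t * star t = 1 := by
    funext j
    simp [Complex.mul_conj', ht j]
  dsimp only
  rw [hVf, star_mul', mul_mul_mul_comm, htt, one_mul]

end Kernel

end RadialBergman

theorem theorem3p5 {n : ℕ} (Ω : Set (Fin n → ℂ)) (ω : (Fin n → ℂ) → ℝ≥0∞)
    (hΩ : RadialBergman.IsReinhardtDomain Ω) (hbdd : Bornology.IsBounded Ω)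
    (hω : RadialBergman.IsMultiRadialWeight Ω ω) (hadm : RadialBergman.IsAdmissible Ω ω)
    (hfeas : RadialBergman.IsFeasible Ω ω)
    (R : RadialBergman.BergmanSpace Ω ω → RadialBergman.BergmanSpace Ω ω) :
    (RadialBergman.IsBoundedOperator R ∧ RadialBergman.IsRadial R) ↔
      ∃ (u : RadialBergman.PeriodicDistribution n) (g : (Fin n → ℂ) → ℂ),
        (∃ C : ℝ, ∀ α ∈ RadialBergman.allowable Ω ω, ‖u.fourierCoeff α‖ ≤ C) ∧
        RadialBergman.IsInducedBy Ω ω g u ∧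
        DifferentiableOn ℂ g (Ω ∪ RadialBergman.conjProduct Ω) ∧
        (∀ ζ ∈ Ω ∪ RadialBergman.conjProduct Ω, HasSum
          (fun α : RadialBergman.allowable Ω ω =>
            ((RadialBergman.coeffNorm Ω ω α ^ 2 : ℝ) : ℂ) * u.fourierCoeff α *
              RadialBergman.monomial (α : Fin n → ℤ) ζ) (g ζ)) ∧
        ∀ f : RadialBergman.BergmanSpace Ω ω, ∀ z ∈ Ω,
          Integrable (fun w => f.1 w * g (z * star w)) (RadialBergman.weightMeasure Ω ω) ∧
          (R f).1 z = ∫ w, f.1 w * g (z * star w) ∂(RadialBergman.weightMeasure Ω ω) := by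
  open RadialBergman in
  constructor
  · rintro ⟨hR, hrad⟩
    obtain ⟨l, ⟨C, hC⟩, hl⟩ := exists_eigenvalues hΩ hω hadm hR hrad
    obtain ⟨hs, hd⟩ := differentiableOn_kernel hΩ hω hadm hfeas hC
    have hg := fun ζ hζ => (hs ζ hζ).of_norm.hasSum
    refine ⟨ofCoeff l ⟨C, hC⟩, _, ⟨C, fun α _ => ?_⟩,
      isInducedBy_ofCoeff hΩ hω hadm hfeas ⟨C, hC⟩ fun ζ hζ => hg ζ (Or.inl hζ), hd, ?_,
      fun f z hz => ?_⟩
    · rw [fourierCoeff_ofCoeff]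
      exact hC α
    · simpa only [fourierCoeff_ofCoeff] using hg
    · obtain ⟨hint, hsum⟩ := hasSum_integral_kernel hΩ hω hadm (fun α _ => hC α)
        (fun ζ hζ => hg ζ (Or.inr hζ)) f hz
      exact ⟨hint, (hasSum_of_diagonal hΩ hω hadm hR hl f hz).unique hsum⟩
  · rintro ⟨u, g, ⟨C, hC⟩, -, -, hg, h⟩
    refine ⟨⟨⟨fun f₁ f₂ => bergman_ext fun z hz => ?_, fun c f => bergman_ext fun z hz => ?_⟩,
      max C 0, fun f => ?_⟩, isRadial_of_integral_kernel hΩ hω h⟩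
    · rw [(h _ z hz).2]
      change _ = (R f₁).1 z + (R f₂).1 z
      rw [(h f₁ z hz).2, (h f₂ z hz).2, ← integral_add (h f₁ z hz).1 (h f₂ z hz).1]
      refine integral_congr_ae (ae_of_all _ fun w => ?_)
      exact add_mul (f₁.1 w) (f₂.1 w) _
    · rw [(h _ z hz).2]
      change _ = c * (R f).1 z
      rw [(h f z hz).2, ← integral_const_mul]
      refine integral_congr_ae (ae_of_all _ fun w => ?_)
      exact mul_assoc c (f.1 w) _
    · refine norm_le_of_hasSum hΩ hω hadm (le_max_right C 0)
        (fun α => (hC α α.2.1).trans (le_max_left C 0)) fun z hz => ?_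
      rw [(h f z hz).2]
      exact (hasSum_integral_kernel hΩ hω hadm hC (fun ζ hζ => hg ζ (Or.inr hζ)) f hz).2
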